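/- Let $\mathbb F_q$ be a finite field with $q$ elements, $K$ an algebraic closure of it, and let $m,r,n$ be positive integers with $q>n$ and $m+2\le r\le n-m$. Let $\lambda=1^{\lambda_1}2^{\lambda_2}\cdots n^{\lambda_n}$ be a factorization pattern, i.e. $\lambda_i\ge 0$ are integers with $\lambda_1+2\lambda_2+\cdots+n\lambda_n=n$, and put $\ell_{i,j}:=\sum_{k<i}k\lambda_k+(j-1)i$ for $1\le i\le n$, $1\le j\le\lambda_i$. For $1\le i\le n$ let $\theta_i$ be a normal element of $\mathbb F_{q^i}\subset K$ over $\mathbb F_q$, i.e. $\theta_i,\theta_i^{q},\dots,\theta_i^{q^{i-1}}$ is a basis of $\mathbb F_{q^i}$ over $\mathbb F_q$. Define linear forms $Y_1,\dots,Y_n\in K[X_1,\dots,X_n]$ by $$Y_{\ell_{i,j}+k}:=\sum_{h=1}^{i}\big(\theta_i^{q^{h-1}}\big)^{q^{k-1}}X_{\ell_{i,j}+h}\qquad(1\le k\le i,\ 1\le j\le\lambda_i,\ 1\le i\le n),$$ and let $\Pi_1,\dots,\Pi_n$ be the elementary symmetric polynomials in $n$ variables. Let $L_1,\dots,L_m\in\mathbb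 F_q[A_r,\dots,A_{n-1}]$ be linearly independent linear forms, let $\alpha_1,\dots,\alpha_m\in\mathbb F_q$, and set $$R_j:=L_j\big((-1)^{n-r}\Pi_{n-r}(Y),\dots,-\Pi_1(Y)\big)+\alpha_j\qquad(1\le j\le m),$$ where $A_k$ is replaced by $(-1)^{n-k}\Pi_{n-k}(Y)$. We regard $R_j$ as a polynomial in $X_1,\dots,X_n$ through $Y=Y(X)$, and we write $\partial R/\partial Y$ for the Jacobian matrix of $R_1,\dots,R_m$ as polynomials in $Y_1,\dots,Y_n$. Let $V\subset\mathbb A^n=K^n$ be the set of common zeros of $R_1,\dots,R_m$. The dimension of a subset of $\mathbb A^n$ is the supremum of the lengths of strictly increasing chains of nonempty irreducible varieties contained in it (and $-\infty$ for the empty set). The degree of an irreducible variety $C$ is the maximum number of points of $C\cap\Lambda$ over the affine linear subspaces $\Lambda$ of codimension $\dim C$ with $C\cap\Lambda$ finite, and the degree of a variety is the sum of the degrees of its irreducible components. A point $x\in V$ is singular if the dimension of the tangent space $T_xV$ (the common kernel of the differentials at $x$ of all polynomials vanishing on $V$) differs from the maximum of the dimensions of the irreducible components of $V$ through $x$; $\mathrm{Sing}(V)$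 is the set of singular points. Then: 1. $V$ is an ideal-theoretic complete intersection of dimension $n-m$: the polynomials $R_1,\dots,R_m$ form a regular sequence in $K[X_1,\dots,X_n]$, they generate a radical ideal, and $V$ and all its irreducible components have dimension $n-m$. Moreover $\deg V\le\prod_{j=1}^m\deg R_j$. 2. The set of points $x\in\mathbb A^n$ for which the matrix $(\partial R/\partial Y)(Y(x))$ has rank less than $m$ has dimension at most $n-r-1$. In particular, the singular locus $\mathrm{Sing}(V)$ has dimension at most $n-r-1$. -/

import Mathlib

open MvPolynomial

noncomputable section

namespace SparseFamily

/-! ### Affine varieties in `𝔸ⁿ = Kⁿ` (with `K` algebraically closed) -/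

section Geometry

variable {K : Type*} [Field K] {n : ℕ}

/-- `W ⊆ Kⁿ` is an affine variety: the set of common zeros of an ideal (equivalently, of finitely
many polynomials) of `K[X₁,…,Xₙ]`. -/
def IsVariety (W : Set (Fin n → K)) : Prop :=
  ∃ I : Ideal (MvPolynomial (Fin n) K), W = zeroLocus K I

/-- A nonempty variety which is not a union of two proper subvarieties. -/
structure IsIrreducibleVariety (W : Set (Fin n → K)) : Prop where
  isVariety : IsVariety W
  nonempty : W.Nonempty
  irreducible : ∀ W₁ W₂ : Set (Fin n → K), IsVariety W₁ → IsVariety W₂ →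
    W = W₁ ∪ W₂ → W = W₁ ∨ W = W₂

/-- The dimension of `V ⊆ Kⁿ`: the supremum of the lengths of the chains
`V₀ ⊊ V₁ ⊊ ⋯ ⊊ V_s` of (nonempty) irreducible varieties contained in `V`.
It is `⊥` when `V` is empty. -/
def dim (V : Set (Fin n → K)) : WithBot ℕ∞ :=
  Order.krullDim {W : Set (Fin n → K) // IsIrreducibleVariety W ∧ W ⊆ V}

/-- The irreducible components of `V`: the maximal irreducible varieties contained in `V`. -/
def components (V : Set (Fin n → K)) : Set (Set (Fin n → K)) :=
  {C | Maximal (fun W => IsIrreducibleVariety W ∧ W ⊆ V) C}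

/-- The degree of an irreducible variety `C`: the maximal number of points of `C ∩ L`, where `L`
runs over the affine linear subspaces of `Kⁿ` of codimension `dim C` for which `C ∩ L` is finite. -/
def irreducibleDegree (C : Set (Fin n → K)) : ℕ∞ :=
  ⨆ (L : AffineSubspace K (Fin n → K))
    (_ : ((Module.finrank K L.direction : ℕ) : WithBot ℕ∞) + dim C = (n : WithBot ℕ∞))
    (_ : (C ∩ (L : Set (Fin n → K))).Finite),
    (C ∩ (L : Set (Fin n → K))).encard

/-- The degree of a variety: the sum of the degrees of its irreducible components
(the sum is written as the supremum of its finite partial sums). -/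
def degree (V : Set (Fin n → K)) : ℕ∞ :=
  ⨆ s : Finset (components V), ∑ C ∈ s, irreducibleDegree (C : Set (Fin n → K))

/-- The local dimension `dim_x V`: the maximum of the dimensions of the irreducible components
of `V` that contain `x`. -/
def dimAt (V : Set (Fin n → K)) (x : Fin n → K) : WithBot ℕ∞ :=
  ⨆ (C : Set (Fin n → K)) (_ : C ∈ components V) (_ : x ∈ C), dim C

/-- The tangent space `T_x V`: the common kernel of the differentials at `x` of the polynomials
of the defining ideal `I(V)`; this is the kernel of the Jacobian matrix at `x` of any system of
generators of `I(V)`. -/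
def tangentSpace (V : Set (Fin n → K)) (x : Fin n → K) : Submodule K (Fin n → K) where
  carrier := {v | ∀ f ∈ vanishingIdeal K V, ∑ i, aeval x (pderiv i f) * v i = 0}
  zero_mem' := by intro f _; simp
  add_mem' := by
    intro v w hv hw f hf
    simp only [Pi.add_apply, mul_add, Finset.sum_add_distrib, hv f hf, hw f hf, add_zero]
  smul_mem' := by
    intro c v hv f hf
    have h := congrArg (fun t => c * t) (hv f hf)
    simp only [mul_zero, Finset.mul_sum] at h
    rw [← h]
    refine Finset.sum_congr rfl fun i _ => ?_
    simp only [Pi.smul_apply, smul_eq_mul]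
    ring

/-- The singular locus of `V`: the points `x` of `V` with `dim T_x V ≠ dim_x V`. -/
def singularLocus (V : Set (Fin n → K)) : Set (Fin n → K) :=
  {x | x ∈ V ∧ ((Module.finrank K (tangentSpace V x) : ℕ) : WithBot ℕ∞) ≠ dimAt V x}

/-- `V` is an ideal-theoretic complete intersection defined by `F₁,…,F_m`: it is the set of common
zeros of these polynomials, they form a regular sequence, and the ideal they generate is radical. -/
structure IsIdealTheoreticCompleteIntersection {m : ℕ} (V : Set (Fin n → K))
    (F : Fin m → MvPolynomial (Fin n) K) : Prop where
  eq_zeros : V = {x | ∀ j, aeval x (F j) = 0}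
  isRegular : RingTheory.Sequence.IsRegular (MvPolynomial (Fin n) K) (List.ofFn F)
  isRadical : (Ideal.span (Set.range F)).IsRadical

/-- The Jacobian matrix `(∂F_j/∂Y_k)` evaluated at the point `y`. -/
def jacobianAt {F : Type*} [Field F] [Algebra F K] {m : ℕ} (f : Fin m → MvPolynomial (Fin n) F)
    (y : Fin n → K) : Matrix (Fin m) (Fin n) K :=
  Matrix.of fun j k => aeval y (pderiv k (f j))

end Geometry

/-! ### The polynomials attached to a linear family and a factorization pattern -/

/-- For a factorization pattern `1^{λ₁} 2^{λ₂} ⋯ n^{λₙ}` with `λ₁ + 2λ₂ + ⋯ + nλₙ = n`, the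
division of `n` coordinates into consecutive blocks: first `λ₁` blocks of length `1`, then `λ₂`
blocks of length `2`, and so on. The `j`-th block of length `i` consists of the positions
`ℓ_{i,j}+1, …, ℓ_{i,j}+i` where `ℓ_{i,j} = ∑_{k<i} k λ_k + (j-1) i`. -/
def patternBlocks (n : ℕ) (lam : ℕ → ℕ) (h : ∑ i ∈ Finset.Icc 1 n, i * lam i = n) :
    Composition n where
  blocks := (List.range n).flatMap fun i => List.replicate (lam (i + 1)) (i + 1)
  blocks_pos := by
    intro i hi
    obtain ⟨a, -, ha⟩ := List.mem_flatMap.1 hi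
    rw [List.eq_of_mem_replicate ha]
    exact Nat.succ_pos a
  blocks_sum := by
    have key : ∀ N : ℕ,
        ((List.range N).flatMap fun i => List.replicate (lam (i + 1)) (i + 1)).sum
          = ∑ i ∈ Finset.Icc 1 N, i * lam i := by
      intro N
      induction N with
      | zero => simp
      | succ N ih =>
        rw [List.range_succ, List.flatMap_append, List.sum_append, ih,
          Finset.sum_Icc_succ_top (by omega)]
        simp [mul_comm]
    rw [key, h]

section Family

variable {F K : Type*} [Field F] [Fintype F] [Field K] [Algebra F K]

/-- With `q = #F`, the element `θ ∈ K` is a normal element of `𝔽_{q^i} = {x ∈ K : x^{q^i} = x}`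
over `F`: the elements `θ, θ^q, …, θ^{q^{i-1}}` are a basis of `𝔽_{q^i}` as an `F`-vector space. -/
structure IsNormalElement (F : Type*) {K : Type*} [Field F] [Fintype F] [Field K] [Algebra F K]
    (i : ℕ) (θ : K) : Prop where
  mem : θ ^ (Fintype.card F ^ i) = θ
  linearIndependent : LinearIndependent F fun h : Fin i => θ ^ (Fintype.card F ^ (h : ℕ))
  spans : ∀ x : K, x ^ (Fintype.card F ^ i) = x →
    x ∈ Submodule.span F (Set.range fun h : Fin i => θ ^ (Fintype.card F ^ (h : ℕ)))

/-- The linear forms `Y₁,…,Yₙ ∈ K[X₁,…,Xₙ]`. On a block of length `i` they are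
`Y_{ℓ+k} = ∑_h σ_k(θ_i^{q^h}) X_{ℓ+h}`, where the `σ_k : x ↦ x^{q^k}` (`0 ≤ k < i`) are the elements
of the Galois group of `𝔽_{q^i}` over `F = 𝔽_q`. -/
def linearFormY (F : Type*) {K : Type*} [Field F] [Fintype F] [Field K] {n : ℕ}
    (c : Composition n) (θ : ℕ → K) (p : Fin n) : MvPolynomial (Fin n) K :=
  ∑ h : Fin (c.blocksFun (c.index p)),
    C ((θ (c.blocksFun (c.index p)) ^ (Fintype.card F ^ (h : ℕ))) ^
        (Fintype.card F ^ (c.invEmbedding p : ℕ))) *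
      X (c.embedding (c.index p) h)

/-- The polynomial `L((-1)^{n-r} Π_{n-r}, …, -Π₁) + α` in the indeterminates `Y₁,…,Yₙ`, where `L` is
a polynomial in the indeterminates `A_r,…,A_{n-1}`, the `Π_k` are the elementary symmetric
polynomials of `F[Y₁,…,Yₙ]`, and `A_k` is replaced by `(-1)^{n-k} Π_{n-k}`. -/
def polyInY {n r : ℕ} (L : MvPolynomial (Set.Ico r n) F) (α : F) : MvPolynomial (Fin n) F :=
  aeval (fun k : Set.Ico r n =>
    (-1 : MvPolynomial (Fin n) F) ^ (n - (k : ℕ)) * esymm (Fin n) F (n - (k : ℕ))) L + C α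

/-- The polynomial `R = L((-1)^{n-r} Π_{n-r}(Y(X)), …, -Π₁(Y(X))) + α` in the
indeterminates `X₁,…,Xₙ`. -/
def polyR {n r : ℕ} (c : Composition n) (θ : ℕ → K) (L : MvPolynomial (Set.Ico r n) F) (α : F) :
    MvPolynomial (Fin n) K :=
  aeval (linearFormY F c θ) (polyInY L α)

end Family

end SparseFamily

end

/-! Since the `θ i` are normal, the forms `Y` are a linear change of coordinates: on each block the
coefficient matrix is a Moore matrix of elements independent over `F`, hence invertible. By Vieta
each `R j` is `α j` plus a linear form in the coefficients of `∏ (T - Y p)`. Completing the `m`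
independent forms to an invertible matrix gives a polynomial ring `A` in `m + k = n` variables,
embedded in `S = K[X]` with image `K[coefficients]`, whose first `m` variables map to the `R j`.
Everything in part 1 except the degree bound follows from `S` being finite free over `A`
(`exists_basis_of_swap`), as `regular_radical_equidimensional` shows.

Faithful flatness carries the regular sequence of variables to `R`. Going-down makes every minimal
prime `q` over `(R)` contract to the ideal of the first `m` variables, so `S ⧸ q` is integral over a
polynomial ring in `k = n - m` variables and all its maximal ideals have height `k`. For radicality,
`r ≥ 2` leaves the coefficients of degree 0 and 1 unconstrained on the slice where the first `m`
variables vanish, so some specialization of `∏ (T - Y p)` there is separable. Fibres over points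
with nonzero discriminant are reduced, and freeness spreads this from a dense open set to the whole
slice.

The degree bound is a Bézout inequality proved by counting. For each component, linear forms cutting
it in finitely many points are analytically independent at each of them
(`eq_zero_of_sum_mul_aeval_mem`). Hence products of powers of the `R j`, powers of these forms and
one interpolating factor per point are linearly independent. Comparing their number in bounded
degree with the number of monomials bounds the number of points (`card_le_prod_totalDegree`).

For part 2, a dependency among the rows of the Jacobian is a polynomial of degree at most `n - r -
1` vanishing at every value `y p`, so deficient rank forces fewer than `n - r` distinct values. Such
points lie in finitely many linear subspaces of dimension at most `n - r - 1`. Where the rank is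
`m`, radicality identifies the tangent space with a kernel of dimension `n - m`, so the point is
nonsingular. -/

noncomputable section

namespace SparseFamily

/-! ### Heights of maximal ideals in integral extensions of polynomial rings -/

section Heights

/-- Some maximal ideal attains the Krull dimension. By the Nullstellensatz maximal ideals are
points, and translations permute the points transitively. -/
theorem height_eq_card_of_isMaximal {K ι : Type*} [Field K] [IsAlgClosed K] [Fintype ι]
    (M : Ideal (MvPolynomial ι K)) (hM : M.IsMaximal) : M.height = Fintype.card ι := by
  have hdim : ringKrullDim (MvPolynomial ι K) = (Fintype.card ι : WithBot ℕ∞) := by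
    simp [MvPolynomial.ringKrullDim_of_isNoetherianRing]
  have : FiniteRingKrullDim (MvPolynomial ι K) := by
    rw [finiteRingKrullDim_iff_ne_bot_and_top, hdim]
    exact ⟨WithBot.natCast_ne_bot _, fun h => ENat.natCast_ne_top _ (WithBot.coe_injective h)⟩
  obtain ⟨N, hN, hNh⟩ := Ideal.exists_isMaximal_height (R := MvPolynomial ι K)
  rw [hdim] at hNh
  replace hNh : N.height = Fintype.card ι := by exact_mod_cast hNh
  obtain ⟨x, rfl⟩ := isMaximal_iff_eq_vanishingIdeal_singleton.1 hM
  obtain ⟨y, rfl⟩ := isMaximal_iff_eq_vanishingIdeal_singleton.1 hN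
  have inv : ∀ d : ι → K, (aeval (fun i => X i + C (-d i)) :
      MvPolynomial ι K →ₐ[K] MvPolynomial ι K).comp (aeval fun i => X i + C (d i)) =
        AlgHom.id K _ := by
    intro d; ext i; simp
  have inv' : ∀ d : ι → K, (aeval (fun i => X i + C (d i)) :
      MvPolynomial ι K →ₐ[K] MvPolynomial ι K).comp (aeval fun i => X i + C (-d i)) =
        AlgHom.id K _ := by
    intro d; ext i; simp
  let e : MvPolynomial ι K ≃ₐ[K] MvPolynomial ι K :=
    AlgEquiv.ofAlgHom (aeval fun i => X i + C (x i - y i)) (aeval fun i => X i + C (-(x i - y i)))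
      (inv' fun i => x i - y i) (inv fun i => x i - y i)
  rw [← hNh, ← e.toRingEquiv.height_comap (vanishingIdeal K {y})]
  congr 1
  ext p
  simp only [mem_vanishingIdeal_singleton_iff, Ideal.mem_comap]
  have : (aeval y : MvPolynomial ι K →ₐ[K] K).comp e.toAlgHom = aeval x := by
    ext i; simp [e]
  rw [← this]; rfl

variable {K κ D : Type*} [Field K] [IsAlgClosed K] [Fintype κ] [CommRing D] [IsDomain D]
  [Algebra (MvPolynomial κ K) D] [Algebra.IsIntegral (MvPolynomial κ K) D]

theorem ringKrullDim_le_of_isIntegral {R S : Type*} [CommRing R] [CommRing S] [Algebra R S]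
    [Algebra.IsIntegral R S] : ringKrullDim S ≤ ringKrullDim R :=
  Order.krullDim_le_of_strictMono (PrimeSpectrum.comap (algebraMap R S)) fun _ _ h =>
    Ideal.IsIntegral.comap_lt_comap (R := R) h

/-- The polynomial ring is integrally closed, so going-down holds for the domain `D`: a maximal
chain below the contraction of `M` lifts to a chain below `M`. Incomparability gives the upper
bound. -/
theorem height_eq_card_of_isMaximal_of_isIntegral
    (hinj : Function.Injective (algebraMap (MvPolynomial κ K) D))
    (M : Ideal D) (hM : M.IsMaximal) : M.height = Fintype.card κ := by
  have : FaithfulSMul (MvPolynomial κ K) D := (faithfulSMul_iff_algebraMap_injective _ _).2 hinj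
  have hm : (M.under (MvPolynomial κ K)).IsMaximal :=
    Ideal.isMaximal_comap_of_isIntegral_of_isMaximal M
  apply le_antisymm
  · have h := Ideal.height_le_ringKrullDim_of_ne_top hM.ne_top
    have h2 := h.trans (ringKrullDim_le_of_isIntegral (R := MvPolynomial κ K))
    have h3 : ringKrullDim (MvPolynomial κ K) = (Fintype.card κ : WithBot ℕ∞) := by
      simp [MvPolynomial.ringKrullDim_of_isNoetherianRing]
    rw [h3] at h2
    exact_mod_cast h2
  · have h := height_eq_card_of_isMaximal _ hm
    obtain ⟨l, hl, hlen⟩ := (M.under (MvPolynomial κ K)).exists_ltSeries_length_eq_height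
    have : M.LiesOver l.last.asIdeal := (Ideal.liesOver_iff _ _).2 (by rw [hl])
    obtain ⟨l', h1, h2, -⟩ := Ideal.exists_ltSeries_of_hasGoingDown l M
    rw [← h, ← hlen, ← h1]
    have hp : M.IsPrime := hM.isPrime
    rw [(⟨M, hp⟩ : PrimeSpectrum D).height_eq_orderHeight]
    apply Order.length_le_height
    rw [h2]

theorem ringKrullDim_eq_card_of_isIntegral
    (hinj : Function.Injective (algebraMap (MvPolynomial κ K) D)) :
    ringKrullDim D = (Fintype.card κ : WithBot ℕ∞) := by
  apply le_antisymm
  · refine (ringKrullDim_le_of_isIntegral (R := MvPolynomial κ K)).trans_eq ?_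
    simp [MvPolynomial.ringKrullDim_of_isNoetherianRing]
  · obtain ⟨M, hM⟩ := Ideal.exists_maximal D
    have := height_eq_card_of_isMaximal_of_isIntegral hinj M hM
    have h := Ideal.height_le_ringKrullDim_of_ne_top hM.ne_top
    rw [this] at h
    exact_mod_cast h

end Heights

/-! ### Equidimensionality of a flat integral extension over a coordinate subspace -/

section Parameters

variable {K ι κ S : Type*} [Field K] [CommRing S] [Algebra (MvPolynomial (ι ⊕ κ) K) S]

variable (K ι κ) in
/-- The ideal generated by the first group of variables. -/
def inlIdeal : Ideal (MvPolynomial (ι ⊕ κ) K) := Ideal.span (Set.range fun i => X (Sum.inl i))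

variable (K ι κ) in
/-- Setting the first group of variables to zero. -/
def killInl : MvPolynomial (ι ⊕ κ) K →ₐ[K] MvPolynomial κ K := aeval (Sum.elim 0 X)

theorem killInl_rename (p : MvPolynomial κ K) : killInl K ι κ (rename Sum.inr p) = p := by
  have : (killInl K ι κ).comp (rename Sum.inr) = AlgHom.id K _ := by
    ext i; simp [killInl]
  exact DFunLike.congr_fun this p

theorem sub_rename_killInl_mem (p : MvPolynomial (ι ⊕ κ) K) :
    p - rename Sum.inr (killInl K ι κ p) ∈ inlIdeal K ι κ := by
  have hX : ∀ i, (X (Sum.inl i) : MvPolynomial (ι ⊕ κ) K) ∈ inlIdeal K ι κ := fun i =>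
    Ideal.subset_span (Set.mem_range_self i)
  rw [← Ideal.Quotient.mk_eq_mk_iff_sub_mem]
  have : (Ideal.Quotient.mkₐ K (inlIdeal K ι κ)) =
      ((Ideal.Quotient.mkₐ K (inlIdeal K ι κ)).comp (rename Sum.inr)).comp (killInl K ι κ) := by
    refine MvPolynomial.algHom_ext fun i => ?_
    rcases i with i | i
    · simpa [killInl] using Ideal.Quotient.eq_zero_iff_mem.2 (hX i)
    · simp [killInl]
  exact DFunLike.congr_fun this p

theorem mem_inlIdeal_iff (p : MvPolynomial (ι ⊕ κ) K) :
    p ∈ inlIdeal K ι κ ↔ killInl K ι κ p = 0 := by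
  constructor
  · intro h
    have : inlIdeal K ι κ ≤ RingHom.ker (killInl K ι κ) := by
      rw [inlIdeal, Ideal.span_le]
      rintro _ ⟨i, rfl⟩
      simp [killInl]
    exact this h
  · intro h
    simpa [h] using sub_rename_killInl_mem p

instance : (inlIdeal K ι κ).IsPrime := by
  have : inlIdeal K ι κ = RingHom.ker (killInl K ι κ) := by
    ext p; exact mem_inlIdeal_iff p
  rw [this]; exact RingHom.ker_isPrime _

/-- Flatness gives going-down: were the contraction strictly larger, a smaller prime over `inlIdeal`
would lie below `q`, against minimality. -/
theorem under_eq_inlIdeal_of_mem_minimalPrimes [Module.Flat (MvPolynomial (ι ⊕ κ) K) S]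
    (q : Ideal S) (hq : q ∈ ((inlIdeal K ι κ).map (algebraMap _ S)).minimalPrimes) :
    q.under (MvPolynomial (ι ⊕ κ) K) = inlIdeal K ι κ := by
  have hqp : q.IsPrime := hq.1.1
  have hle : inlIdeal K ι κ ≤ q.under (MvPolynomial (ι ⊕ κ) K) := Ideal.map_le_iff_le_comap.1 hq.1.2
  by_contra hne
  obtain ⟨P, hP, hPp, hPo⟩ := Algebra.HasGoingDown.exists_ideal_le_liesOver_of_lt q
    (lt_of_le_of_ne hle (Ne.symm hne))
  have h1 : (inlIdeal K ι κ).map (algebraMap _ S) ≤ P := by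
    rw [Ideal.map_le_iff_le_comap, hPo.over]
  have : P = q := le_antisymm hP (hq.2 ⟨hPp, h1⟩ hP)
  exact hne (by rw [← this]; exact hPo.over.symm)

variable [IsAlgClosed K] [Fintype κ] [Module.Flat (MvPolynomial (ι ⊕ κ) K) S]
  [Algebra.IsIntegral (MvPolynomial (ι ⊕ κ) K) S]

/-- As `q` contracts exactly to `inlIdeal`, the structure map to `S ⧸ q` factors through `killInl`.
This makes `S ⧸ q` an injective integral extension of the polynomial ring in `κ`. -/
theorem equidimensional_of_mem_minimalPrimes
    (q : Ideal S) (hq : q ∈ ((inlIdeal K ι κ).map (algebraMap _ S)).minimalPrimes) :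
    (∀ M : Ideal (S ⧸ q), M.IsMaximal → M.height = Fintype.card κ) ∧
      ringKrullDim (S ⧸ q) = (Fintype.card κ : WithBot ℕ∞) := by
  have hqp : q.IsPrime := hq.1.1
  have hund := under_eq_inlIdeal_of_mem_minimalPrimes q hq
  let f : MvPolynomial (ι ⊕ κ) K →+* S ⧸ q := (Ideal.Quotient.mk q).comp (algebraMap _ S)
  let g : MvPolynomial κ K →+* S ⧸ q := f.comp (rename Sum.inr : _ →ₐ[K] _).toRingHom
  have hker : ∀ p, f p = 0 ↔ killInl K ι κ p = 0 := by
    intro p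
    rw [← mem_inlIdeal_iff, ← hund, Ideal.under_def, Ideal.mem_comap]
    exact Ideal.Quotient.eq_zero_iff_mem
  have hfg : g.comp (killInl K ι κ).toRingHom = f := by
    refine RingHom.ext fun p => ?_
    have := (hker _).2 ((mem_inlIdeal_iff _).1 (sub_rename_killInl_mem p))
    rw [map_sub, sub_eq_zero] at this
    exact this.symm
  have hf : f.IsIntegral :=
    RingHom.IsIntegral.trans _ _ (algebraMap_isIntegral_iff.2 inferInstance)
      (RingHom.isIntegral_of_surjective _ Ideal.Quotient.mk_surjective)
  have hg : g.IsIntegral := RingHom.IsIntegral.tower_top _ _ (hfg ▸ hf)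
  let := g.toAlgebra
  have : Algebra.IsIntegral (MvPolynomial κ K) (S ⧸ q) := ⟨hg⟩
  have hinj : Function.Injective (algebraMap (MvPolynomial κ K) (S ⧸ q)) := by
    rw [injective_iff_map_eq_zero]
    intro p hp
    have := (hker _).1 hp
    simpa [killInl_rename] using this
  exact ⟨height_eq_card_of_isMaximal_of_isIntegral hinj, ringKrullDim_eq_card_of_isIntegral hinj⟩

end Parameters

/-! ### Freeness of a ring generated by roots over the symmetric subring -/

section Freeness

variable {R S : Type*} [CommRing R] [CommRing S] [Algebra R S]

/-- A subalgebra is finite free over the base, expressed by a finite family of elements. -/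
def HasFiniteBasis (B : Subalgebra R S) : Prop :=
  ∃ (d : ℕ) (b : Fin d → S), LinearIndependent R b ∧
    Submodule.span R (Set.range b) = Subalgebra.toSubmodule B

theorem hasFiniteBasis_bot (hinj : Function.Injective (algebraMap R S)) :
    HasFiniteBasis (⊥ : Subalgebra R S) := by
  refine ⟨1, fun _ => 1, ?_, ?_⟩
  · rw [Fintype.linearIndependent_iff]
    intro g hg i
    rw [Subsingleton.elim i 0]
    simp only [Finset.univ_unique, Finset.sum_singleton] at hg
    apply hinj
    simpa [Algebra.smul_def] using hg
  · rw [Algebra.toSubmodule_bot, Set.range_const, Submodule.one_eq_span]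

/-- Adjoining a root `y` of a monic polynomial over `B`, if no nonzero polynomial over `B` of
smaller degree vanishes at `y`. -/
theorem HasFiniteBasis.adjoin_root {B B' : Subalgebra R S} (hB : HasFiniteBasis B)
    (y : S) (hB' : B' = (Algebra.adjoin B {y}).restrictScalars R) (f : Polynomial B) (hf : f.Monic)
    (hfy : Polynomial.aeval y f = 0)
    (hind : ∀ c : Fin f.natDegree → B, ∑ j, (c j : S) * y ^ (j : ℕ) = 0 → c = 0) :
    HasFiniteBasis B' := by
  classical
  subst hB'
  obtain ⟨d, b, hb, hspan⟩ := hB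
  have hbB : ∀ i, b i ∈ B := fun i => by
    have : b i ∈ Submodule.span R (Set.range b) := Submodule.subset_span ⟨i, rfl⟩
    rw [hspan] at this; exact this
  let v : Fin d × Fin f.natDegree → S := fun p => b p.1 * y ^ (p.2 : ℕ)
  let e : Fin (d * f.natDegree) ≃ Fin d × Fin f.natDegree := finProdFinEquiv.symm
  refine ⟨d * f.natDegree, v ∘ e, ?_, ?_⟩
  · rw [linearIndependent_equiv e]
    rw [Fintype.linearIndependent_iff]
    rintro g hg ⟨i, j⟩
    let c : Fin f.natDegree → B := fun j => ∑ i, g (i, j) • ⟨b i, hbB i⟩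
    have hc : c = 0 := by
      apply hind
      rw [← hg, Fintype.sum_prod_type_right]
      refine Finset.sum_congr rfl fun j _ => ?_
      simp only [c, v, AddSubmonoidClass.coe_finsetSum, Finset.sum_mul]
      refine Finset.sum_congr rfl fun i _ => ?_
      simp
    have hj : ∑ i, g (i, j) • b i = 0 := by
      have := congrArg (fun x : B => (x : S)) (congrFun hc j)
      simpa [c] using this
    exact Fintype.linearIndependent_iff.1 hb _ hj i
  · rw [e.surjective.range_comp v]
    apply le_antisymm
    · rw [Submodule.span_le]
      rintro _ ⟨⟨i, j⟩, rfl⟩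
      have h1 : b i ∈ Algebra.adjoin B {y} :=
        (Algebra.adjoin B {y}).algebraMap_mem (⟨b i, hbB i⟩ : B)
      have h2 : y ∈ Algebra.adjoin B {y} := Algebra.subset_adjoin (Set.mem_singleton y)
      exact Subalgebra.mul_mem _ h1 (Subalgebra.pow_mem _ h2 j)
    · intro x hx
      change x ∈ Algebra.adjoin B {y} at hx
      rw [Algebra.adjoin_singleton_eq_range_aeval] at hx
      obtain ⟨p, rfl⟩ := hx
      have hmod : Polynomial.aeval y p = Polynomial.aeval y (p %ₘ f) := by
        conv_lhs => rw [← Polynomial.modByMonic_add_div p f]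
        simp [hfy]
      change Polynomial.aeval y p ∈ _
      rw [hmod, Polynomial.aeval_eq_sum_range]
      refine Submodule.sum_mem _ fun j hj => ?_
      by_cases hjd : j < f.natDegree
      · have hcoef : ((p %ₘ f).coeff j : S) ∈ Submodule.span R (Set.range b) := by
          rw [hspan]; exact ((p %ₘ f).coeff j).2
        rw [Submodule.mem_span_range_iff_exists_fun] at hcoef
        obtain ⟨c, hc⟩ := hcoef
        rw [Algebra.smul_def]
        change ((p %ₘ f).coeff j : S) * _ ∈ _
        rw [← hc, Finset.sum_mul]
        refine Submodule.sum_mem _ fun i _ => ?_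
        rw [smul_mul_assoc]
        exact Submodule.smul_mem _ _ (Submodule.subset_span ⟨(i, ⟨j, hjd⟩), rfl⟩)
      · have : (p %ₘ f).coeff j = 0 := by
          nontriviality B
          apply Polynomial.coeff_eq_zero_of_degree_lt
          refine (Polynomial.degree_modByMonic_lt p hf).trans_le ?_
          rw [Polynomial.degree_eq_natDegree hf.ne_zero]
          exact_mod_cast not_lt.1 hjd
        rw [this, zero_smul]; exact Submodule.zero_mem _

/-- A ring generated by the roots of a monic polynomial with coefficients in a subring that is
fixed by all permutations of these roots is finite free over that subring. -/
theorem exists_basis_of_swap [IsDomain S] {n : ℕ} (y : Fin n → S) (hy : Function.Injective y)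
    (hinj : Function.Injective (algebraMap R S))
    (hgen : Algebra.adjoin R (Set.range y) = ⊤)
    (f : Polynomial R) (hf : f.map (algebraMap R S) = ∏ i, (Polynomial.X - Polynomial.C (y i)))
    (hswap : ∀ i j, ∃ σ : S →ₐ[R] S, ∀ l, σ (y l) = y (Equiv.swap i j l)) :
    ∃ d, Nonempty (Module.Basis (Fin d) R S) := by
  -- Tower adjoining the roots one at a time; each stage is free over the previous one.
  let B : ℕ → Subalgebra R S := fun k => Algebra.adjoin R (y '' {l | (l : ℕ) < k})
  have key : ∀ k ≤ n, HasFiniteBasis (B k) := by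
    intro k
    induction k with
    | zero =>
      intro _
      have : B 0 = ⊥ := by simp [B]
      rw [this]; exact hasFiniteBasis_bot hinj
    | succ k ih =>
      intro hk
      let i : Fin n := ⟨k, hk⟩
      have hyB : ∀ l : Fin n, (l : ℕ) < k → y l ∈ B k := fun l hl =>
        Algebra.subset_adjoin ⟨l, hl, rfl⟩
      let yB : Fin n → B k := fun l => if hl : (l : ℕ) < k then ⟨y l, hyB l hl⟩ else 0
      have hyBc : ∀ l : Fin n, (l : ℕ) < k → (yB l : S) = y l := fun l hl => by simp [yB, hl]
      let p : Polynomial (B k) := ∏ l with l.val < k, (Polynomial.X - Polynomial.C (yB l))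
      have hp : p.Monic := Polynomial.monic_prod_of_monic _ _ fun l _ => Polynomial.monic_X_sub_C _
      let F : Polynomial (B k) := f.map (algebraMap R (B k))
      have hBinj : Function.Injective (algebraMap (B k) S) := Subtype.val_injective
      have hFmap : F.map (algebraMap (B k) S) = ∏ i, (Polynomial.X - Polynomial.C (y i)) := by
        rw [← hf, Polynomial.map_map, ← IsScalarTower.algebraMap_eq]
      have hpmap : p.map (algebraMap (B k) S) =
          ∏ l with l.val < k, (Polynomial.X - Polynomial.C (y l)) := by
        rw [Polynomial.map_prod]
        refine Finset.prod_congr rfl fun l hl => ?_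
        simp only [Finset.mem_filter] at hl
        simp only [Polynomial.map_sub, Polynomial.map_X, Polynomial.map_C]
        rw [← hyBc l hl.2]; rfl
      -- Removing the roots already adjoined leaves a monic `g` of degree `n - k` over `B k` that
      -- kills the next root.
      obtain ⟨g, hg⟩ : p ∣ F := by
        rw [← Polynomial.map_dvd_map _ hBinj hp, hFmap, hpmap]
        exact Finset.prod_dvd_prod_of_subset _ _ _ (Finset.filter_subset _ _)
      have hFm : F.Monic := by
        refine Polynomial.monic_of_injective hBinj ?_
        rw [hFmap]
        exact Polynomial.monic_prod_of_monic _ _ fun l _ => Polynomial.monic_X_sub_C _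
      have hgm : g.Monic := hp.of_mul_monic_left (hg ▸ hFm)
      have hgmap : g.map (algebraMap (B k) S) =
          ∏ l with ¬ l.val < k, (Polynomial.X - Polynomial.C (y l)) := by
        have h1 := congrArg (Polynomial.map (algebraMap (B k) S)) hg
        rw [Polynomial.map_mul, hFmap, hpmap,
          ← Finset.prod_filter_mul_prod_filter_not Finset.univ (fun l : Fin n => l.val < k)] at h1
        refine (mul_left_cancel₀ ?_ h1).symm
        exact (Polynomial.monic_prod_of_monic _ _ fun l _ => Polynomial.monic_X_sub_C _).ne_zero
      refine (ih (by omega)).adjoin_root (y i) ?_ g hgm ?_ ?_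
      · have : y '' {l | (l : ℕ) < k + 1} = y '' {l | (l : ℕ) < k} ∪ {y i} := by
          ext x
          simp only [Set.mem_image, Set.mem_ofPred_eq, Set.mem_union, Set.mem_singleton_iff]
          constructor
          · rintro ⟨l, hl, rfl⟩
            rcases Nat.lt_succ_iff_lt_or_eq.1 hl with h | h
            · exact Or.inl ⟨l, h, rfl⟩
            · exact Or.inr (congrArg y (Fin.ext h))
          · rintro (⟨l, hl, rfl⟩ | rfl)
            · exact ⟨l, by omega, rfl⟩
            · exact ⟨i, by simp [i], rfl⟩
        change Algebra.adjoin R _ = _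
        rw [this, Algebra.adjoin_union_eq_adjoin_adjoin]
      · rw [← Polynomial.eval_map_algebraMap, hgmap, Polynomial.eval_prod]
        exact Finset.prod_eq_zero (i := i) (by simp [i]) (by simp)
      · intro c hc
        let P : Polynomial (B k) := ∑ j, Polynomial.C (c j) * Polynomial.X ^ (j : ℕ)
        have hP : ∀ x : S, (P.map (algebraMap (B k) S)).eval x =
            ∑ j, (c j : S) * x ^ (j : ℕ) := by
          intro x
          simp only [P, Polynomial.map_sum, Polynomial.eval_finsetSum, Polynomial.map_mul,
            Polynomial.map_pow, Polynomial.map_X, Polynomial.map_C, Polynomial.eval_mul,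
            Polynomial.eval_C, Polynomial.eval_pow, Polynomial.eval_X]
          rfl
        -- The transposition of `i` and `l` fixes `B k`, so a relation for `y i` over `B k` also
        -- holds for each of the `n - k` remaining roots. They are distinct and the degree is below
        -- `n - k`, so the relation is trivial.
        have hroot : ∀ l : Fin n, ¬ l.val < k → (P.map (algebraMap (B k) S)).eval (y l) = 0 := by
          intro l hl
          obtain ⟨σ, hσ⟩ := hswap i l
          have hfix : ∀ b ∈ B k, σ b = b := by
            intro b hb
            have : B k ≤ AlgHom.equalizer σ (AlgHom.id R S) := by
              refine Algebra.adjoin_le ?_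
              rintro _ ⟨a, ha, rfl⟩
              change σ (y a) = y a
              rw [hσ, Equiv.swap_apply_of_ne_of_ne]
              · rintro rfl; exact lt_irrefl _ (show k < k from ha)
              · rintro rfl; exact hl ha
            exact this hb
          rw [hP]
          have := congrArg σ hc
          simp only [map_sum, map_mul, map_pow, hσ, Equiv.swap_apply_left, map_zero] at this
          rw [← this]
          exact Finset.sum_congr rfl fun j _ => by rw [hfix _ (c j).2]
        have hcard : g.natDegree = (Finset.univ.filter fun l : Fin n => ¬ l.val < k).card := by
          rw [← Polynomial.natDegree_map_eq_of_injective hBinj, hgmap,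
            Polynomial.natDegree_prod_of_monic _ _ fun l _ => Polynomial.monic_X_sub_C _]
          simp
        have hdeg : P.degree < g.natDegree := by
          refine (Polynomial.degree_sum_le _ _).trans_lt ?_
          rw [Finset.sup_lt_iff (by exact_mod_cast WithBot.bot_lt_coe _)]
          intro j _
          exact (Polynomial.degree_C_mul_X_pow_le _ _).trans_lt (by exact_mod_cast j.2)
        have hP0 : P = 0 := by
          apply Polynomial.map_injective _ hBinj
          rw [Polynomial.map_zero]
          refine Polynomial.eq_zero_of_degree_lt_of_eval_index_eq_zero (v := y)
            (Finset.univ.filter fun l : Fin n => ¬ l.val < k) hy.injOn ?_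
            fun l hl => hroot l (by simpa using hl)
          rw [← hcard]
          exact (Polynomial.degree_map_le).trans_lt hdeg
        funext j
        have := congrArg (fun q => Polynomial.coeff q j) hP0
        simpa [P, Polynomial.finsetSum_coeff, Polynomial.coeff_C_mul, Polynomial.coeff_X_pow,
          Fin.val_inj] using this
  obtain ⟨d, b, hb, hspan⟩ := key n le_rfl
  have hBn : B n = ⊤ := by
    have : y '' {l | (l : ℕ) < n} = Set.range y := by
      rw [← Set.image_univ]; congr; ext l; simp
    change Algebra.adjoin R _ = _
    rw [this, hgen]
  refine ⟨d, ⟨Module.Basis.mk hb ?_⟩⟩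
  rw [hspan, hBn]; simp

end Freeness

/-! ### Varieties, prime ideals and dimension -/

section Dictionary

variable {K : Type*} [Field K] {n : ℕ}

theorem isVariety_zeroLocus (I : Ideal (MvPolynomial (Fin n) K)) : IsVariety (zeroLocus K I) :=
  ⟨I, rfl⟩

theorem IsVariety.zeroLocus_vanishingIdeal {W : Set (Fin n → K)} (hW : IsVariety W) :
    zeroLocus K (vanishingIdeal K W) = W := by
  obtain ⟨I, rfl⟩ := hW
  exact zeroLocus_vanishingIdeal_galoisConnection.l_u_l_eq_l I

theorem IsVariety.subset_iff {W W' : Set (Fin n → K)} (hW' : IsVariety W') :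
    W ⊆ W' ↔ vanishingIdeal K W' ≤ vanishingIdeal K W := by
  refine ⟨vanishingIdeal_anti_mono, fun h => ?_⟩
  have := le_zeroLocus_iff_le_vanishingIdeal.2 h
  rwa [hW'.zeroLocus_vanishingIdeal] at this

theorem zeroLocus_mul (I J : Ideal (MvPolynomial (Fin n) K)) :
    zeroLocus K (I * J) = zeroLocus K I ∪ zeroLocus K J := by
  ext x
  constructor
  · intro hx
    by_contra h
    simp only [Set.mem_union, not_or, mem_zeroLocus_iff, not_forall] at h
    obtain ⟨⟨p, hp, hpx⟩, q, hq, hqx⟩ := h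
    have := hx _ (Ideal.mul_mem_mul hp hq)
    rw [map_mul] at this
    exact (mul_ne_zero hpx hqx) this
  · rintro (hx | hx)
    · exact zeroLocus_anti_mono Ideal.mul_le_left hx
    · exact zeroLocus_anti_mono Ideal.mul_le_right hx

theorem IsVariety.inter {W₁ W₂ : Set (Fin n → K)} (h₁ : IsVariety W₁) (h₂ : IsVariety W₂) :
    IsVariety (W₁ ∩ W₂) := by
  obtain ⟨I, rfl⟩ := h₁
  obtain ⟨J, rfl⟩ := h₂
  exact ⟨I ⊔ J, (zeroLocus_vanishingIdeal_galoisConnection.l_sup).symm⟩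

theorem isPrime_vanishingIdeal {W : Set (Fin n → K)} (hW : IsIrreducibleVariety W) :
    (vanishingIdeal K W).IsPrime := by
  refine ⟨?_, ?_⟩
  · intro h
    obtain ⟨x, hx⟩ := hW.nonempty
    have : (1 : MvPolynomial (Fin n) K) ∈ vanishingIdeal K W := h ▸ Submodule.mem_top
    simpa using this x hx
  · intro p q hpq
    have hv : ∀ p : MvPolynomial (Fin n) K, IsVariety (W ∩ zeroLocus K (Ideal.span {p})) :=
      fun p => hW.isVariety.inter (isVariety_zeroLocus _)
    have hz : ∀ (p : MvPolynomial (Fin n) K) x, x ∈ zeroLocus K (Ideal.span {p}) ↔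
        aeval x p = 0 := by intro p x; rw [zeroLocus_span]; simp
    have hW' : ∀ p, W = W ∩ zeroLocus K (Ideal.span {p}) → p ∈ vanishingIdeal K W := by
      intro p h x hx
      rw [h] at hx
      exact (hz p x).1 hx.2
    rcases hW.irreducible _ _ (hv p) (hv q) (by
      ext x
      simp only [Set.mem_union, Set.mem_inter_iff, hz]
      constructor
      · intro hx
        have := hpq x hx
        rw [map_mul, mul_eq_zero] at this
        tauto
      · tauto) with h | h
    · exact Or.inl (hW' p h)
    · exact Or.inr (hW' q h)

theorem IsIrreducibleVariety.subset_of_subset_biUnion {ι : Type*} {W : Set (Fin n → K)}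
    (hW : IsIrreducibleVariety W) (s : Finset ι) (I : ι → Ideal (MvPolynomial (Fin n) K))
    (h : W ⊆ ⋃ i ∈ s, zeroLocus K (I i)) : ∃ i ∈ s, W ⊆ zeroLocus K (I i) := by
  have hp := isPrime_vanishingIdeal hW
  have : ∏ i ∈ s, I i ≤ vanishingIdeal K W := by
    intro p hpI x hx
    obtain ⟨i, hi, hxi⟩ := Set.mem_iUnion₂.1 (h hx)
    exact hxi p ((Ideal.prod_le_inf.trans (Finset.inf_le hi)) hpI)
  obtain ⟨i, hi, hle⟩ := (hp.prod_le).1 this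
  exact ⟨i, hi, le_zeroLocus_iff_le_vanishingIdeal.2 hle⟩

theorem dim_mono {V W : Set (Fin n → K)} (h : V ⊆ W) : dim V ≤ dim W :=
  Order.krullDim_le_of_strictMono
    (fun C : {C : Set (Fin n → K) // IsIrreducibleVariety C ∧ C ⊆ V} =>
      (⟨C.1, C.2.1, C.2.2.trans h⟩ : {C : Set (Fin n → K) // IsIrreducibleVariety C ∧ C ⊆ W}))
    fun _ _ h => h

/-- A chain lies inside its largest member, so dimension can be tested on irreducible subvarieties.
No closedness of `V` is needed, which allows rank loci and singular loci to be treated as bare sets.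
-/
theorem dim_le_of_forall_irreducible {V : Set (Fin n → K)} {d : WithBot ℕ∞}
    (h : ∀ W, IsIrreducibleVariety W → W ⊆ V → dim W ≤ d) : dim V ≤ d := by
  refine iSup_le fun l => ?_
  refine le_trans ?_ (h l.last.1 l.last.2.1 l.last.2.2)
  let f : ∀ i, {C : Set (Fin n → K) // IsIrreducibleVariety C ∧ C ⊆ l.last.1} := fun i =>
    ⟨(l i).1, (l i).2.1, LTSeries.monotone l (Fin.le_last i)⟩
  exact le_iSup_of_le (α := WithBot ℕ∞) (f := fun p : LTSeries
    {C : Set (Fin n → K) // IsIrreducibleVariety C ∧ C ⊆ l.last.1} => (p.length : WithBot ℕ∞))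
    ⟨l.length, f, fun i => l.step i⟩ le_rfl

variable [IsAlgClosed K]

theorem isIrreducibleVariety_zeroLocus (P : Ideal (MvPolynomial (Fin n) K)) (hP : P.IsPrime) :
    IsIrreducibleVariety (zeroLocus K P) := by
  have hvan : vanishingIdeal K (zeroLocus K P) = P := IsPrime.vanishingIdeal_zeroLocus P
  refine ⟨isVariety_zeroLocus P, ?_, ?_⟩
  · by_contra h
    rw [Set.not_nonempty_iff_eq_empty] at h
    rw [h, vanishingIdeal_empty] at hvan
    exact hP.ne_top hvan.symm
  · rintro W₁ W₂ ⟨I, rfl⟩ ⟨J, rfl⟩ h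
    have hle : I * J ≤ P := by
      rw [← hvan, ← le_zeroLocus_iff_le_vanishingIdeal, zeroLocus_mul, ← h]
    rcases hP.mul_le.1 hle with h1 | h1
    · exact Or.inl (le_antisymm (zeroLocus_anti_mono h1) (h ▸ Set.subset_union_left))
    · exact Or.inr (le_antisymm (zeroLocus_anti_mono h1) (h ▸ Set.subset_union_right))

/-- Irreducible varieties inside `V` correspond to primes containing the ideal of `V`. -/
def irreducibleOrderIso (V : Set (Fin n → K)) (hV : IsVariety V) :
    {W : Set (Fin n → K) // IsIrreducibleVariety W ∧ W ⊆ V} ≃o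
      (PrimeSpectrum.zeroLocus (vanishingIdeal K V : Set (MvPolynomial (Fin n) K)))ᵒᵈ where
  toFun W := OrderDual.toDual ⟨⟨vanishingIdeal K W.1, isPrime_vanishingIdeal W.2.1⟩,
    vanishingIdeal_anti_mono W.2.2⟩
  invFun P := ⟨zeroLocus K (OrderDual.ofDual P).1.asIdeal,
    isIrreducibleVariety_zeroLocus _ (OrderDual.ofDual P).1.2, by
      have := zeroLocus_anti_mono (K := K) (OrderDual.ofDual P).2
      rwa [hV.zeroLocus_vanishingIdeal] at this⟩
  left_inv W := Subtype.ext W.2.1.isVariety.zeroLocus_vanishingIdeal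
  right_inv P := by
    apply OrderDual.ofDual.injective
    apply Subtype.ext
    apply PrimeSpectrum.ext
    have := (OrderDual.ofDual P).1.2
    exact IsPrime.vanishingIdeal_zeroLocus _
  map_rel_iff' {W W'} := W'.2.1.isVariety.subset_iff.symm

theorem dim_eq_ringKrullDim {V : Set (Fin n → K)} (hV : IsVariety V) :
    dim V = ringKrullDim (MvPolynomial (Fin n) K ⧸ vanishingIdeal K V) := by
  rw [ringKrullDim_quotient, dim, Order.krullDim_eq_of_orderIso (irreducibleOrderIso V hV),
    Order.krullDim_orderDual]

theorem vanishingIdeal_mem_minimalPrimes {V C : Set (Fin n → K)} (hV : IsVariety V)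
    (hC : C ∈ components V) : vanishingIdeal K C ∈ (vanishingIdeal K V).minimalPrimes := by
  refine ⟨⟨isPrime_vanishingIdeal hC.1.1, vanishingIdeal_anti_mono hC.1.2⟩, ?_⟩
  rintro Q ⟨hQ, hVQ⟩ hQC
  have h1 : zeroLocus K Q ⊆ V := by
    have := zeroLocus_anti_mono (K := K) hVQ
    rwa [hV.zeroLocus_vanishingIdeal] at this
  have h2 : C ⊆ zeroLocus K Q := by
    have := zeroLocus_anti_mono (K := K) hQC
    rwa [hC.1.1.isVariety.zeroLocus_vanishingIdeal] at this
  have h3 : zeroLocus K Q ⊆ C := hC.2 ⟨isIrreducibleVariety_zeroLocus Q hQ, h1⟩ h2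
  have := vanishingIdeal_anti_mono (k := K) h3
  rwa [IsPrime.vanishingIdeal_zeroLocus Q] at this

theorem exists_component_mem {V : Set (Fin n → K)} (hV : IsVariety V) {x : Fin n → K}
    (hx : x ∈ V) : ∃ C ∈ components V, x ∈ C := by
  obtain ⟨q, hq, hqx⟩ := Ideal.exists_minimalPrimes_le (I := vanishingIdeal K V)
    (J := vanishingIdeal K {x}) (vanishingIdeal_anti_mono (Set.singleton_subset_iff.2 hx))
  refine ⟨zeroLocus K q, ⟨⟨isIrreducibleVariety_zeroLocus q hq.1.1, ?_⟩, ?_⟩, ?_⟩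
  · have := zeroLocus_anti_mono (K := K) hq.1.2
    rwa [hV.zeroLocus_vanishingIdeal] at this
  · rintro W ⟨hW, hWV⟩ hqW
    have h1 : vanishingIdeal K W ≤ q := by
      have := vanishingIdeal_anti_mono (k := K) hqW
      have hp := hq.1.1
      rwa [IsPrime.vanishingIdeal_zeroLocus q] at this
    have h2 := hq.2 ⟨isPrime_vanishingIdeal hW, vanishingIdeal_anti_mono hWV⟩ h1
    have := zeroLocus_anti_mono (K := K) h2
    rwa [hW.isVariety.zeroLocus_vanishingIdeal] at this
  · have := zeroLocus_anti_mono (K := K) hqx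
    exact this (fun p hp => hp x rfl)

end Dictionary

/-! ### Linear independence of power products of a regular sequence -/

section RegularSequence

/-- `F₁,…,F_m` is a (weakly) regular sequence, in terms of elements. -/
def IsRegularFamily {S : Type*} [CommRing S] {m : ℕ} (F : Fin m → S) : Prop :=
  ∀ i x, F i * x ∈ Ideal.span (F '' Set.Iio i) → x ∈ Ideal.span (F '' Set.Iio i)

theorem isWeaklyRegular_ofFn_iff {S : Type*} [CommRing S] {m : ℕ} (F : Fin m → S) :
    RingTheory.Sequence.IsWeaklyRegular S (List.ofFn F) ↔ IsRegularFamily F := by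
  have hset : ∀ i : Fin m, {x | x ∈ (List.ofFn F).take i} = F '' Set.Iio i := by
    intro i
    ext x
    simp only [Set.mem_ofPred_eq, List.mem_iff_getElem, List.getElem_take, List.getElem_ofFn,
      List.length_take, List.length_ofFn, Set.mem_image, Set.mem_Iio]
    constructor
    · rintro ⟨a, ha, rfl⟩
      exact ⟨⟨a, by omega⟩, Fin.lt_def.2 (by simp; omega), rfl⟩
    · rintro ⟨a, ha, rfl⟩
      exact ⟨a, by have := Fin.lt_def.1 ha; omega, rfl⟩
  have hreg : ∀ i : Fin m, IsSMulRegular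
      (S ⧸ (Ideal.ofList ((List.ofFn F).take i) • ⊤ : Submodule S S)) (F i) ↔
      ∀ x, F i * x ∈ Ideal.span (F '' Set.Iio i) → x ∈ Ideal.span (F '' Set.Iio i) := by
    intro i
    have h0 : (Ideal.ofList ((List.ofFn F).take i) • ⊤ : Submodule S S) =
        Ideal.span (F '' Set.Iio i) := by
      rw [Ideal.ofList, hset, smul_eq_mul, Ideal.mul_top]
    rw [isSMulRegular_iff_right_eq_zero_of_smul, h0]
    constructor
    · intro h x hx
      have := h (Submodule.Quotient.mk x) (by
        rw [← Submodule.Quotient.mk_smul, Submodule.Quotient.mk_eq_zero]; exact hx)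
      exact (Submodule.Quotient.mk_eq_zero _).1 this
    · intro h x
      obtain ⟨x, rfl⟩ := Submodule.Quotient.mk_surjective _ x
      intro hx
      rw [← Submodule.Quotient.mk_smul, Submodule.Quotient.mk_eq_zero] at hx
      exact (Submodule.Quotient.mk_eq_zero _).2 (h x hx)
  rw [RingTheory.Sequence.isWeaklyRegular_iff, IsRegularFamily]
  constructor
  · intro h i
    have := h i (by simp)
    rw [← hreg i]
    simpa using this
  · intro h i hi
    have hi' : i < m := by simpa using hi
    have := (hreg ⟨i, hi'⟩).2 (h ⟨i, hi'⟩)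
    simpa using this

variable {K S : Type*} [Field K] [CommRing S] [Algebra K S]

theorem linearIndependent_mk_iff {ι : Type*} (I : Ideal S) (v : ι → S) :
    LinearIndependent K (fun i => Ideal.Quotient.mk I (v i)) ↔
      ∀ l : ι →₀ K, Finsupp.linearCombination K v l ∈ I → l = 0 := by
  rw [linearIndependent_iff]
  refine forall_congr' fun l => ?_
  have : Finsupp.linearCombination K (fun i => Ideal.Quotient.mk I (v i)) l =
      Ideal.Quotient.mkₐ K I (Finsupp.linearCombination K v l) := by
    simp only [Finsupp.linearCombination_apply, Finsupp.sum, map_sum, map_smul]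
    rfl
  rw [this, Ideal.Quotient.mkₐ_eq_mk, Ideal.Quotient.eq_zero_iff_mem]

/-- In a relation modulo `I`, the part without `f` vanishes modulo `I ⊔ (f)`, hence is trivial. What
remains is divisible by `f`, which can be cancelled modulo `I`. -/
theorem linearIndependent_pow_mul {ι : Type*} (I : Ideal S) (f : S)
    (hf : ∀ x, f * x ∈ I → x ∈ I) (v : ι → S)
    (hv : LinearIndependent K fun i => Ideal.Quotient.mk (I ⊔ Ideal.span {f}) (v i)) :
    LinearIndependent K fun p : ℕ × ι => Ideal.Quotient.mk I (f ^ p.1 * v p.2) := by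
  rw [linearIndependent_mk_iff] at hv ⊢
  have key : ∀ (N : ℕ) (c : ℕ → ι →₀ K),
      ∑ j ∈ Finset.range N, f ^ j * Finsupp.linearCombination K v (c j) ∈ I →
        ∀ j < N, c j = 0 := by
    intro N
    induction N with
    | zero => intro c _ j hj; omega
    | succ N ih =>
      intro c hc
      rw [Finset.sum_range_succ'] at hc
      have hsum : ∑ j ∈ Finset.range N, f ^ (j + 1) * Finsupp.linearCombination K v (c (j + 1)) =
          f * ∑ j ∈ Finset.range N, f ^ j * Finsupp.linearCombination K v (c (j + 1)) := by
        rw [Finset.mul_sum]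
        exact Finset.sum_congr rfl fun j _ => by ring
      rw [hsum, pow_zero, one_mul] at hc
      have h0 : c 0 = 0 := by
        apply hv
        have h1 := Ideal.mem_sup_left (T := Ideal.span {f}) hc
        have h2 : f * ∑ j ∈ Finset.range N, f ^ j * Finsupp.linearCombination K v (c (j + 1)) ∈
            I ⊔ Ideal.span {f} := Ideal.mem_sup_right (Ideal.mem_span_singleton'.2 ⟨_, mul_comm _ _⟩)
        exact (Ideal.add_mem_iff_right _ h2).1 h1
      rw [h0, map_zero, add_zero] at hc
      have := ih (fun j => c (j + 1)) (hf _ hc)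
      intro j hj
      rcases j with _ | j
      · exact h0
      · exact this j (by omega)
  intro l hl
  classical
  obtain ⟨N, hN⟩ : ∃ N, ∀ j ∈ l.curry.support, j < N :=
    ⟨l.curry.support.sup id + 1, fun j hj => Nat.lt_succ_of_le (Finset.le_sup (f := id) hj)⟩
  have h1 : ∑ j ∈ Finset.range N, f ^ j * Finsupp.linearCombination K v (l.curry j) =
      Finsupp.linearCombination K (fun p : ℕ × ι => f ^ p.1 * v p.2) l := by
    rw [Finsupp.linearCombination_apply,
      ← Finsupp.sum_curry_index l (fun j i c => c • (f ^ j * v i)), Finsupp.sum]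
    rw [← Finset.sum_subset (s₁ := l.curry.support) (fun j hj => Finset.mem_range.2 (hN j hj))]
    · refine Finset.sum_congr rfl fun j _ => ?_
      rw [Finsupp.linearCombination_apply, Finsupp.sum, Finset.mul_sum]
      exact Finset.sum_congr rfl fun i _ => by rw [mul_smul_comm]
    · intro j _ hj
      rw [Finsupp.notMem_support_iff.1 hj]; simp
  have h2 := key N (fun j => l.curry j) (h1 ▸ hl)
  ext ⟨j, i⟩
  have h3 : l.curry j = 0 := by
    by_cases hj : j < N
    · exact h2 j hj
    · exact Finsupp.notMem_support_iff.1 fun h => hj (hN j h)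
  simpa using DFunLike.congr_fun h3 i

/-- Induction peeling off the last element: its powers are absorbed into the index type of `v`,
which is why `ι` is quantified inside. -/
theorem linearIndependent_prod_pow_mul {m : ℕ} (F : Fin m → S) (hF : IsRegularFamily F) :
    ∀ {ι : Type*} (v : ι → S),
      (LinearIndependent K fun i => Ideal.Quotient.mk (Ideal.span (Set.range F)) (v i)) →
      LinearIndependent K fun p : (Fin m → ℕ) × ι => (∏ j, F j ^ p.1 j) * v p.2 := by
  induction m with
  | zero =>
    intro ι v hv
    rw [linearIndependent_mk_iff] at hv
    have hv' : LinearIndependent K v := by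
      rw [linearIndependent_iff]
      intro l hl
      exact hv l (hl ▸ Submodule.zero_mem _)
    have := hv'.comp (Prod.snd : (Fin 0 → ℕ) × ι → ι) (by
      rintro ⟨a, i⟩ ⟨b, j⟩ h
      exact Prod.ext (Subsingleton.elim _ _) h)
    simpa [Function.comp_def] using this
  | succ m ih =>
    intro ι v hv
    have himg : ∀ s : Set (Fin m), Fin.init F '' s = F '' (Fin.castSucc '' s) := by
      intro s; rw [← Set.image_comp]; rfl
    have hIio : ∀ i : Fin m, Fin.castSucc '' Set.Iio i = Set.Iio i.castSucc := by
      intro i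
      ext x
      simp only [Set.mem_image, Set.mem_Iio]
      constructor
      · rintro ⟨a, ha, rfl⟩; exact Fin.castSucc_lt_castSucc_iff.2 ha
      · intro hx
        exact ⟨x.castLT (lt_trans (Fin.lt_def.1 hx) i.2), Fin.lt_def.2 (Fin.lt_def.1 hx), rfl⟩
    have hlast : Fin.init F '' Set.univ = F '' Set.Iio (Fin.last m) := by
      rw [himg]
      congr 1
      ext x
      simp only [Set.image_univ, Set.mem_range, Set.mem_Iio]
      constructor
      · rintro ⟨a, rfl⟩; exact Fin.castSucc_lt_last a
      · intro hx; exact ⟨x.castLT (Fin.lt_def.1 hx), rfl⟩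
    have hF' : IsRegularFamily (Fin.init F) := by
      intro i x hx
      rw [himg, hIio] at hx ⊢
      exact hF i.castSucc x hx
    have hspan : Ideal.span (Set.range F) =
        Ideal.span (Set.range (Fin.init F)) ⊔ Ideal.span {F (Fin.last m)} := by
      rw [← Ideal.span_union, ← Set.image_univ (f := Fin.init F), hlast, ← Set.image_singleton,
        ← Set.image_union, ← Set.image_univ]
      congr 2
      ext x
      simp only [Set.mem_univ, Set.mem_union, Set.mem_Iio, Set.mem_singleton_iff, true_iff]
      exact lt_or_eq_of_le (Fin.le_last x)
    rw [hspan] at hv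
    have h1 := linearIndependent_pow_mul _ _ (fun x hx => by
      rw [← Set.image_univ, hlast] at hx ⊢
      exact hF _ x hx) v hv
    have h2 := ih (Fin.init F) hF' _ h1
    let e : (Fin (m + 1) → ℕ) × ι → (Fin m → ℕ) × (ℕ × ι) :=
      fun p => (Fin.init p.1, p.1 (Fin.last m), p.2)
    have he : Function.Injective e := by
      rintro ⟨a, i⟩ ⟨b, j⟩ h
      simp only [e, Prod.mk.injEq] at h
      obtain ⟨h3, h4, rfl⟩ := h
      refine Prod.ext ?_ rfl
      rw [← Fin.snoc_init_self a, ← Fin.snoc_init_self b, h3, h4]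
    have := h2.comp e he
    convert this using 1
    funext p
    simp only [Function.comp, e, Fin.prod_univ_castSucc, mul_assoc]
    rfl

end RegularSequence

/-! ### Counting monomials of bounded degree -/

section Counting

/-- The exponent vectors of total degree at most `d`. -/
def simplex (ι : Type*) [Fintype ι] [DecidableEq ι] (d : ℕ) : Finset (ι → ℕ) :=
  (Fintype.piFinset fun _ => Finset.range (d + 1)).filter fun x => ∑ i, x i ≤ d

theorem mem_simplex {ι : Type*} [Fintype ι] [DecidableEq ι] {d : ℕ} {x : ι → ℕ} :
    x ∈ simplex ι d ↔ ∑ i, x i ≤ d := by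
  simp only [simplex, Finset.mem_filter, Fintype.mem_piFinset, Finset.mem_range,
    and_iff_right_iff_imp]
  intro h i
  exact Nat.lt_succ_of_le ((Finset.single_le_sum (fun _ _ => Nat.zero_le _)
    (Finset.mem_univ i)).trans h)

theorem card_simplex_le (ι : Type*) [Fintype ι] [DecidableEq ι] (d : ℕ) :
    (simplex ι d).card ≤ (d + 1) ^ Fintype.card ι := by
  refine (Finset.card_filter_le _ _).trans ?_
  rw [Fintype.card_piFinset]; simp

theorem card_simplex_pos (ι : Type*) [Fintype ι] [DecidableEq ι] (d : ℕ) :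
    0 < (simplex ι d).card := Finset.card_pos.2 ⟨0, mem_simplex.2 (by simp)⟩

/-- Exponent vectors `(α, β)` with `∑ α_j D_j + ∑ β_i ≤ d`. -/
def weightedSimplex {m : ℕ} (D : Fin m → ℕ) (k d : ℕ) : Finset ((Fin m → ℕ) × (Fin k → ℕ)) :=
  ((simplex (Fin m) d) ×ˢ (simplex (Fin k) d)).filter
    fun p => ∑ j, p.1 j * D j + ∑ i, p.2 i ≤ d

/-- Dividing the `j`-th exponent by `D j` with remainder injects the simplex into a box of `∏ D j`
remainders times the weighted simplex of quotients. -/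
theorem card_simplex_le_prod_mul {m k : ℕ} (D : Fin m → ℕ) (hD : ∀ j, 0 < D j) (d : ℕ) :
    (simplex (Fin m ⊕ Fin k) d).card ≤ (∏ j, D j) * (weightedSimplex D k d).card := by
  have hcard : (∏ j, D j) * (weightedSimplex D k d).card =
      ((Fintype.piFinset fun j => Finset.range (D j)) ×ˢ weightedSimplex D k d).card := by
    rw [Finset.card_product, Fintype.card_piFinset]; simp
  rw [hcard]
  refine Finset.card_le_card_of_injOn
    (fun x => (fun j => x (Sum.inl j) % D j,
      (fun j => x (Sum.inl j) / D j, fun i => x (Sum.inr i)))) ?_ ?_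
  · intro x hx
    have hx' := mem_simplex.1 hx
    rw [Fintype.sum_sum_type] at hx'
    have h1 : ∑ j, x (Sum.inl j) / D j * D j ≤ ∑ j, x (Sum.inl j) :=
      Finset.sum_le_sum fun j _ => Nat.div_mul_le_self _ _
    have h2 : ∑ j, x (Sum.inl j) / D j ≤ ∑ j, x (Sum.inl j) :=
      Finset.sum_le_sum fun j _ => Nat.div_le_self _ _
    simp only [Finset.coe_product, Set.mem_prod, Finset.mem_coe, Fintype.mem_piFinset,
      Finset.mem_range, weightedSimplex, Finset.mem_filter, Finset.mem_product, mem_simplex]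
    exact ⟨fun j => Nat.mod_lt _ (hD j), ⟨by omega, by omega⟩, by omega⟩
  · intro x _ y _ h
    simp only [Prod.mk.injEq] at h
    obtain ⟨h1, h2, h3⟩ := h
    funext s
    rcases s with j | i
    · rw [← Nat.mod_add_div (x (Sum.inl j)) (D j), ← Nat.mod_add_div (y (Sum.inl j)) (D j),
        congrFun h1 j, congrFun h2 j]
    · exact congrFun h3 i

/-- If `N ≥ D + 1`, iterating the inequality along multiples of `c` makes `B` grow at least like
`((D + 1) / D) ^ j`, against its polynomial bound. Only this crude growth is needed, not the exact
Hilbert polynomial. -/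
theorem le_of_mul_le_mul_add {B : ℕ → ℕ} {N D c e : ℕ} (hB : ∀ d, B d ≤ (d + 1) ^ e)
    (hB0 : 0 < B 0) (h : ∀ d, N * B d ≤ D * B (d + c)) : N ≤ D := by
  by_contra hlt
  have hND : D + 1 ≤ N := by omega
  have hD : 0 < D := by
    rcases Nat.eq_zero_or_pos D with rfl | h0
    · have := h 0
      have : 0 < N * B 0 := Nat.mul_pos (by omega) hB0
      omega
    · exact h0
  have hstep : ∀ j, (D + 1) ^ j ≤ D ^ j * B (j * c) := by
    intro j
    induction j with
    | zero => rw [pow_zero, pow_zero, one_mul, zero_mul]; exact hB0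
    | succ j ih =>
      calc (D + 1) ^ (j + 1) = (D + 1) * (D + 1) ^ j := by ring
        _ ≤ N * (D ^ j * B (j * c)) := Nat.mul_le_mul hND ih
        _ = D ^ j * (N * B (j * c)) := by ring
        _ ≤ D ^ j * (D * B (j * c + c)) := Nat.mul_le_mul_left _ (h _)
        _ = D ^ (j + 1) * B ((j + 1) * c) := by ring_nf
  set r : ℝ := ((D : ℝ) + 1) / D with hr
  have hDr : (0 : ℝ) < D := by exact_mod_cast hD
  have hr1 : 1 < r := by rw [hr, one_lt_div hDr]; linarith
  have hgrow : ∀ j : ℕ, r ^ j ≤ ((j * c + 1 : ℕ) : ℝ) ^ e := by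
    intro j
    rw [hr, div_pow, div_le_iff₀ (by positivity)]
    have h1 := (hstep j).trans (Nat.mul_le_mul_left _ (hB (j * c)))
    have h2 : (((D + 1) ^ j : ℕ) : ℝ) ≤ ((D ^ j * (j * c + 1) ^ e : ℕ) : ℝ) := by exact_mod_cast h1
    push_cast at h2 ⊢
    linarith
  have hlim := tendsto_pow_const_div_const_pow_of_one_lt e hr1
  have hlim2 := hlim.const_mul (((c : ℝ) + 1) ^ e)
  rw [mul_zero] at hlim2
  have hev := (hlim2.eventually (gt_mem_nhds one_pos)).and (Filter.eventually_ge_atTop 1)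
  obtain ⟨j, hj, hj1⟩ := hev.exists
  have hjr : (1 : ℝ) ≤ j := by exact_mod_cast hj1
  have h3 : ((j * c + 1 : ℕ) : ℝ) ^ e ≤ ((c : ℝ) + 1) ^ e * (j : ℝ) ^ e := by
    rw [← mul_pow]
    apply pow_le_pow_left₀ (by positivity)
    push_cast
    nlinarith
  have hrj : 0 < r ^ j := by positivity
  have h4 := hgrow j
  have h5 : ((c : ℝ) + 1) ^ e * ((j : ℝ) ^ e / r ^ j) < 1 := hj
  rw [← mul_div_assoc, div_lt_one hrj] at h5
  linarith

theorem card_le_card_simplex {K τ : Type*} [Field K] [Fintype τ] {n d : ℕ}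
    (u : τ → MvPolynomial (Fin n) K) (hu : LinearIndependent K u)
    (hdeg : ∀ t, (u t).totalDegree ≤ d) : Fintype.card τ ≤ (simplex (Fin n) d).card := by
  classical
  let M : Finset (MvPolynomial (Fin n) K) :=
    (simplex (Fin n) d).image fun x => monomial (Finsupp.equivFunOnFinite.symm x) 1
  have hmem : ∀ t, u t ∈ Submodule.span K (M : Set (MvPolynomial (Fin n) K)) := by
    intro t
    rw [(u t).as_sum]
    refine Submodule.sum_mem _ fun x hx => ?_
    have : monomial x (coeff x (u t)) = (coeff x (u t)) • monomial x (1 : K) := by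
      rw [smul_monomial]; simp
    rw [this]
    refine Submodule.smul_mem _ _ (Submodule.subset_span ?_)
    refine Finset.mem_image.2 ⟨x, mem_simplex.2 ?_, ?_⟩
    · have := (le_totalDegree hx).trans (hdeg t)
      rwa [Finsupp.sum_fintype _ _ (fun _ => rfl)] at this
    · exact congrArg (fun y => monomial y (1 : K)) (Finsupp.equivFunOnFinite.symm_apply_apply x)
  have hu' : LinearIndependent K
      (fun t => (⟨u t, hmem t⟩ : Submodule.span K (M : Set (MvPolynomial (Fin n) K)))) :=
    LinearIndependent.of_comp (Submodule.subtype _) hu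
  exact hu'.fintype_card_le_finrank.trans ((finrank_span_finset_le_card M).trans
    Finset.card_image_le)

end Counting

/-! ### Analytic independence of systems of parameters -/

section AnalyticIndependence

theorem _root_.MvPolynomial.IsHomogeneous.sum_eq_of_mem_support {K ι : Type*} [Field K] [Fintype ι]
    {φ : MvPolynomial ι K} {s : ℕ} (hφ : φ.IsHomogeneous s) {d : ι →₀ ℕ} (hd : d ∈ φ.support) :
    ∑ i, d i = s := by
  by_contra h
  exact mem_support_iff.1 hd (hφ.coeff_eq_zero (by rwa [Finsupp.degree_eq_sum]))

theorem aeval_mem_pow_of_isHomogeneous {K S ι : Type*} [Field K] [CommRing S] [Algebra K S]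
    [Fintype ι] (l : ι → S) {φ : MvPolynomial ι K} {s : ℕ} (hφ : φ.IsHomogeneous s) :
    aeval l φ ∈ Ideal.span (Set.range l) ^ s := by
  rw [φ.as_sum, map_sum]
  refine Submodule.sum_mem _ fun d hd => ?_
  rw [aeval_monomial, Finsupp.prod_fintype _ _ (fun _ => pow_zero _)]
  refine Ideal.mul_mem_left _ _ ?_
  have hdeg : ∑ i, d i = s := hφ.sum_eq_of_mem_support hd
  rw [← hdeg, ← Finset.prod_pow_eq_pow_sum]
  exact Ideal.prod_mem_prod fun i _ => Ideal.pow_mem_pow (Ideal.subset_span (Set.mem_range_self i)) _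

theorem aeval_mem_pow_of_homogeneousComponent_eq_zero {K S ι : Type*} [Field K] [CommRing S]
    [Algebra K S] [Fintype ι] (l : ι → S) {φ : MvPolynomial ι K} {s : ℕ}
    (hφ : ∀ j < s, homogeneousComponent j φ = 0) :
    aeval l φ ∈ Ideal.span (Set.range l) ^ s := by
  rw [← sum_homogeneousComponent φ, map_sum]
  refine Submodule.sum_mem _ fun j _ => ?_
  by_cases hj : j < s
  · rw [hφ j hj, map_zero]; exact Submodule.zero_mem _
  · exact Ideal.pow_le_pow_right (not_lt.1 hj)
      (aeval_mem_pow_of_isHomogeneous l (homogeneousComponent_isHomogeneous j φ))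

/-- Modulo `I` each `l i` is `c i` times `x`, so a form of degree `s` collapses to its value at `c`
times `x ^ s`. -/
theorem aeval_sub_mem_of_isHomogeneous {K S ι : Type*} [Field K] [CommRing S] [Algebra K S]
    [Fintype ι] (l : ι → S) (I : Ideal S) (c : ι → K) (x : S)
    (h : ∀ i, l i - algebraMap K S (c i) * x ∈ I) {φ : MvPolynomial ι K} {s : ℕ}
    (hφ : φ.IsHomogeneous s) :
    aeval l φ - algebraMap K S (eval c φ) * x ^ s ∈ I := by
  have h1 : aeval l φ - aeval (fun i => algebraMap K S (c i) * x) φ ∈ I := by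
    rw [← Ideal.Quotient.mk_eq_mk_iff_sub_mem, ← Ideal.Quotient.mkₐ_eq_mk K,
      ← AlgHom.comp_apply, ← AlgHom.comp_apply, comp_aeval, comp_aeval]
    congr 2
    funext i
    simpa [Ideal.Quotient.mk_eq_mk_iff_sub_mem] using
      (Ideal.Quotient.mk_eq_mk_iff_sub_mem _ _).2 (h i)
  convert h1 using 2
  rw [φ.as_sum, map_sum, map_sum, map_sum, Finset.sum_mul]
  refine Finset.sum_congr rfl fun d hd => ?_
  have hdeg : ∑ i, d i = s := hφ.sum_eq_of_mem_support hd
  rw [aeval_monomial, eval_monomial, Finsupp.prod_fintype _ _ (fun _ => pow_zero _),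
    Finsupp.prod_fintype _ _ (fun _ => pow_zero _)]
  simp only [mul_pow, Finset.prod_mul_distrib, Finset.prod_pow_eq_pow_sum, hdeg, map_mul,
    map_prod, map_pow, mul_assoc]

theorem sup_pow_le {S : Type*} [CommRing S] (A B : Ideal S) (s : ℕ) :
    (A ⊔ B) ^ s ≤ A ⊔ B ^ s := by
  induction s with
  | zero => simp
  | succ s ih =>
    rw [pow_succ]
    refine (Ideal.mul_mono_left ih).trans ?_
    rw [Ideal.sup_mul, Ideal.mul_sup (B ^ s), ← pow_succ]
    refine sup_le (Ideal.mul_le_left.trans le_sup_left) (sup_le ?_ le_sup_right)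
    exact Ideal.mul_le_right.trans le_sup_left

variable {K : Type*} [Field K] [IsAlgClosed K] {n : ℕ}

/-- The product of the maximal ideals of the finitely many zeros lies in `N`, hence one of them
does. -/
theorem eq_vanishingIdeal_singleton_of_finite (N : Ideal (MvPolynomial (Fin n) K)) [hN : N.IsPrime]
    (hfin : (zeroLocus K N).Finite) : N.IsMaximal := by
  have : ∏ x ∈ hfin.toFinset, vanishingIdeal K {x} ≤ N := by
    conv_rhs => rw [← IsPrime.vanishingIdeal_zeroLocus (K := K) N]
    intro p hp x hx
    have := (Ideal.prod_le_inf.trans (Finset.inf_le (hfin.mem_toFinset.2 hx))) hp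
    exact this x rfl
  obtain ⟨x, -, hx⟩ := hN.prod_le.1 this
  have hmax : (vanishingIdeal K {x} : Ideal (MvPolynomial (Fin n) K)).IsMaximal := inferInstance
  rw [← hmax.eq_of_le hN.ne_top hx]
  exact hmax

/-- Krull's height theorem in `S ⧸ Q`. -/
theorem le_card_of_mem_minimalPrimes {S : Type*} [CommRing S] [IsNoetherianRing S] {k : ℕ}
    (Q M : Ideal S) (hM : M.IsMaximal) (hQM : Q ≤ M)
    (hht : ∀ M : Ideal (S ⧸ Q), M.IsMaximal → (k : ℕ∞) ≤ M.height) (s : Finset S)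
    (hmin : M ∈ (Q ⊔ Ideal.span s).minimalPrimes) : k ≤ s.card := by
  classical
  have hsurj : Function.Surjective (Ideal.Quotient.mk Q) := Ideal.Quotient.mk_surjective
  have hmax : (M.map (Ideal.Quotient.mk Q)).IsMaximal :=
    .map_of_surjective_of_ker_le hsurj (by rwa [Ideal.mk_ker])
  have h1 : M.map (Ideal.Quotient.mk Q) ∈
      (Ideal.span ((s.image (Ideal.Quotient.mk Q) : Finset (S ⧸ Q)) : Set (S ⧸ Q))).minimalPrimes := by
    rw [Finset.coe_image, ← Ideal.map_span, Ideal.minimalPrimes_map_of_surjective hsurj,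
      Ideal.mk_ker, sup_comm]
    exact ⟨M, hmin, rfl⟩
  have h2 := (hht _ hmax).trans (Ideal.height_le_card_of_mem_minimalPrimes_span_finset h1)
  exact (Nat.cast_le.1 h2).trans Finset.card_image_le

/-- A form in a system of parameters does not vanish to higher order. -/
theorem false_of_aeval_mem {k : ℕ} (Q M : Ideal (MvPolynomial (Fin n) K)) (hMmax : M.IsMaximal)
    (hht : ∀ M : Ideal (MvPolynomial (Fin n) K ⧸ Q), M.IsMaximal → (k : ℕ∞) ≤ M.height)
    (l : Fin k → MvPolynomial (Fin n) K)
    (hfin : (zeroLocus K (Q ⊔ Ideal.span (Set.range l))).Finite)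
    (hQIM : Q ⊔ Ideal.span (Set.range l) ≤ M) {s : ℕ} (hs : 0 < s) {H : MvPolynomial (Fin k) K}
    (hH : H.IsHomogeneous s) {c : Fin k → K} (hc : eval c H ≠ 0)
    (hHb : aeval l H ∈ Q ⊔ M * Ideal.span (Set.range l) ^ s) : False := by
  classical
  have hQM : Q ≤ M := le_sup_left.trans hQIM
  have hIM : Ideal.span (Set.range l) ≤ M := le_sup_right.trans hQIM
  set I := Ideal.span (Set.range l) with hI
  -- A form of positive degree vanishes at the origin, so `c` is not zero.
  obtain ⟨i₀, hi₀⟩ : ∃ i, c i ≠ 0 := by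
    by_contra h
    push Not at h
    apply hc
    have : c = 0 := funext h
    rw [this, eval_zero, constantCoeff_eq]
    exact hH.coeff_eq_zero (by simpa using hs.ne)
  set x : MvPolynomial (Fin n) K := C (c i₀)⁻¹ * l i₀ with hx
  -- Together with `x` these at most `k - 1` elements generate an ideal containing `I`; the one with
  -- index `i₀` is zero and is omitted.
  let T : Finset (MvPolynomial (Fin n) K) :=
    (Finset.univ.erase i₀).image fun i => l i - C (c i) * x
  have hTcard : T.card < k := by
    refine Finset.card_image_le.trans_lt ?_
    rw [Finset.card_erase_of_mem (Finset.mem_univ _), Finset.card_univ, Fintype.card_fin]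
    have := i₀.pos
    omega
  have hT : ∀ i, l i - C (c i) * x ∈ Ideal.span (T : Set (MvPolynomial (Fin n) K)) := by
    intro i
    by_cases hi : i = i₀
    · have : l i - C (c i) * x = 0 := by
        rw [hi, hx, ← mul_assoc, ← C_mul, mul_inv_cancel₀ hi₀, C_1, one_mul, sub_self]
      rw [this]; exact Submodule.zero_mem _
    · exact Ideal.subset_span (Finset.mem_coe.2 (Finset.mem_image.2 ⟨i, by simp [hi], rfl⟩))
  set I' := Ideal.span (T : Set (MvPolynomial (Fin n) K)) with hI'
  have hII' : I ≤ I' ⊔ Ideal.span {x} := by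
    rw [hI, Ideal.span_le]
    rintro _ ⟨i, rfl⟩
    rw [← sub_add_cancel (l i) (C (c i) * x)]
    exact Ideal.add_mem _ (Ideal.mem_sup_left (hT i))
      (Ideal.mem_sup_right (Ideal.mul_mem_left _ _ (Ideal.mem_span_singleton_self x)))
  have hpow : M * I ^ s ≤ I' ⊔ M * Ideal.span {x ^ s} := by
    have h1 : I ^ s ≤ I' ⊔ Ideal.span {x ^ s} := by
      rw [← Ideal.span_singleton_pow]
      exact (Ideal.pow_right_mono hII' s).trans (sup_pow_le _ _ _)
    refine (Ideal.mul_mono_right h1).trans ?_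
    rw [Ideal.mul_sup]
    exact sup_le_sup_right Ideal.mul_le_right _
  have hxs : C (eval c H) * x ^ s ∈ (Q ⊔ I') ⊔ M * Ideal.span {x ^ s} := by
    have h1 := aeval_sub_mem_of_isHomogeneous l I' c x hT hH
    have h2 : aeval l H ∈ (Q ⊔ I') ⊔ M * Ideal.span {x ^ s} := by
      have : Q ⊔ M * I ^ s ≤ (Q ⊔ I') ⊔ M * Ideal.span {x ^ s} := by
        rw [sup_assoc]
        exact sup_le_sup_left hpow _
      exact this hHb
    have h3 := Ideal.sub_mem _ h2 (Ideal.mem_sup_left (Ideal.mem_sup_right h1))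
    simpa using h3
  obtain ⟨u, hu, v, hv, huv⟩ := Submodule.mem_sup.1 hxs
  obtain ⟨μ, hμ, rfl⟩ := Ideal.mem_mul_span_singleton.1 hv
  -- The first factor is a nonzero constant minus an element of `M`, so any prime inside `M` that
  -- contains `Q ⊔ I'` must contain `x`, hence all of `I`. Its zero set is then finite, so it equals
  -- `M`: the point would be cut out by fewer than `k` equations.
  have hmem : (C (eval c H) - μ) * x ^ s ∈ Q ⊔ I' := by
    rw [sub_mul, ← huv]; simpa using hu
  have hnot : C (eval c H) - μ ∉ M := by
    intro h
    have := Ideal.add_mem _ h hμ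
    rw [sub_add_cancel] at this
    exact hMmax.ne_top (Ideal.eq_top_of_isUnit_mem _ this ((isUnit_iff_ne_zero.2 hc).map _))
  have hlM : ∀ i, l i ∈ M := fun i => hIM (Ideal.subset_span ⟨i, rfl⟩)
  have hmin : M ∈ (Q ⊔ I').minimalPrimes := by
    refine ⟨⟨hMmax.isPrime, sup_le hQM ?_⟩, ?_⟩
    · rw [hI', Ideal.span_le]
      intro f hf
      obtain ⟨i, -, rfl⟩ := Finset.mem_image.1 (Finset.mem_coe.1 hf)
      exact Ideal.sub_mem _ (hlM i) (Ideal.mul_mem_left _ _ (Ideal.mul_mem_left _ _ (hlM i₀)))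
    · rintro N ⟨hN, hQN⟩ hNM
      have hxN : x ∈ N :=
        hN.mem_of_pow_mem s ((hN.mem_or_mem (hQN hmem)).resolve_left fun h => hnot (hNM h))
      have hIN : Q ⊔ I ≤ N := by
        refine sup_le (le_sup_left.trans hQN) (hII'.trans (sup_le (le_sup_right.trans hQN) ?_))
        rwa [Ideal.span_singleton_le_iff_mem]
      have hNmax := eq_vanishingIdeal_singleton_of_finite N
        (hfin.subset (zeroLocus_anti_mono hIN))
      exact (hNmax.eq_of_le hMmax.ne_top hNM).ge
  exact absurd (le_card_of_mem_minimalPrimes Q M hMmax hQM hht T hmin) (not_le.2 hTcard)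

/-- Linear forms that cut out finitely many points on a `k`-dimensional variety are analytically
independent at each of these points. -/
theorem eq_zero_of_sum_mul_aeval_mem {k : ℕ} (Q : Ideal (MvPolynomial (Fin n) K)) [Q.IsPrime]
    (hht : ∀ M : Ideal (MvPolynomial (Fin n) K ⧸ Q), M.IsMaximal → (k : ℕ∞) ≤ M.height)
    (l : Fin k → MvPolynomial (Fin n) K)
    (hfin : (zeroLocus K (Q ⊔ Ideal.span (Set.range l))).Finite)
    {τ : Type*} [Fintype τ] [DecidableEq τ] (p : τ → Fin n → K)
    (hp : ∀ a, p a ∈ zeroLocus K (Q ⊔ Ideal.span (Set.range l)))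
    (q : τ → MvPolynomial (Fin n) K)
    (hq : ∀ a b, aeval (p b) (q a) = if a = b then (1 : K) else 0)
    (G : τ → MvPolynomial (Fin k) K) (hG : ∑ a, q a * aeval l (G a) ∈ Q) : G = 0 := by
  classical
  by_contra hne
  have hex : ∃ j a, homogeneousComponent j (G a) ≠ 0 := by
    by_contra h
    push Not at h
    apply hne
    funext a
    rw [← sum_homogeneousComponent (G a)]
    exact Finset.sum_eq_zero fun j _ => h j a
  -- The lowest degree in which some `G a` has a nonzero component.
  let s := Nat.find hex
  obtain ⟨b, hb⟩ : ∃ a, homogeneousComponent s (G a) ≠ 0 := Nat.find_spec hex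
  have hlt : ∀ j < s, ∀ a, homogeneousComponent j (G a) = 0 := by
    intro j hj a
    by_contra h
    exact Nat.find_min hex hj ⟨a, h⟩
  set H : τ → MvPolynomial (Fin k) K := fun a => homogeneousComponent s (G a) with hH
  have hHhom : ∀ a, (H a).IsHomogeneous s := fun a => homogeneousComponent_isHomogeneous s (G a)
  set I := Ideal.span (Set.range l) with hI
  set M : Ideal (MvPolynomial (Fin n) K) := vanishingIdeal K {p b} with hM
  have hMmax : M.IsMaximal := inferInstanceAs (vanishingIdeal K {p b}).IsMaximal
  have hQIM : Q ⊔ I ≤ M := by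
    intro f hf x hx
    rw [Set.mem_singleton_iff.1 hx]
    exact hp b f hf
  have hQM : Q ≤ M := le_sup_left.trans hQIM
  have hIM : I ≤ M := le_sup_right.trans hQIM
  have hrest : ∀ a, aeval l (G a - H a) ∈ I ^ (s + 1) := by
    intro a
    apply aeval_mem_pow_of_homogeneousComponent_eq_zero
    intro j hj
    rw [map_sub, sub_eq_zero]
    rcases Nat.lt_succ_iff_lt_or_eq.1 hj with h | rfl
    · rw [hlt j h a, homogeneousComponent_of_mem (hHhom a), if_neg h.ne]
    · rw [homogeneousComponent_of_mem (hHhom a), if_pos rfl]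
  -- At the point `p b` the factor `q a` is congruent to 1 or 0 modulo `M`, and the terms of degree
  -- above `s` lie in `I ^ (s + 1)`, inside `M * I ^ s`. Only the leading form of `G b` survives.
  have hHb : aeval l (H b) ∈ Q ⊔ M * I ^ s := by
    have h1 : aeval l (H b) = ∑ a, q a * aeval l (G a) - ∑ a, q a * aeval l (G a - H a) -
        ∑ a, (q a - if a = b then 1 else 0) * aeval l (H a) := by
      simp only [map_sub, mul_sub, sub_mul, Finset.sum_sub_distrib]
      simp
    rw [h1]
    refine Ideal.sub_mem _ (Ideal.sub_mem _ (Ideal.mem_sup_left hG) ?_) ?_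
    · refine Ideal.mem_sup_right (Submodule.sum_mem _ fun a _ => Ideal.mul_mem_left _ _ ?_)
      have := hrest a
      rw [pow_succ'] at this
      exact Ideal.mul_mono_left hIM this
    · refine Ideal.mem_sup_right (Submodule.sum_mem _ fun a _ => Ideal.mul_mem_mul ?_
        (aeval_mem_pow_of_isHomogeneous l (hHhom a)))
      intro x hx
      rw [Set.mem_singleton_iff.1 hx, map_sub, hq]
      split_ifs <;> simp
  obtain ⟨c, hc⟩ : ∃ c, eval c (H b) ≠ 0 := by
    by_contra h
    push Not at h
    exact hb (funext fun c => by rw [h c, map_zero])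
  -- In degree 0 the leading form is a nonzero constant lying in `M`.
  rcases Nat.eq_zero_or_pos s with hs | hs
  · have h0 := hHhom b
    rw [hs, ← totalDegree_zero_iff_isHomogeneous, totalDegree_eq_zero_iff_eq_C] at h0
    rw [h0, eval_C] at hc
    have h1 : aeval l (H b) ∈ M := (sup_le hQM Ideal.mul_le_left) hHb
    rw [h0, aeval_C] at h1
    exact hMmax.ne_top (Ideal.eq_top_of_isUnit_mem _ h1 ((isUnit_iff_ne_zero.2 hc).map _))
  exact false_of_aeval_mem Q M hMmax hht l hfin hQIM hs (hHhom b) hc hHb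

end AnalyticIndependence

/-! ### A Bézout inequality by counting -/

section Bezout

theorem card_simplex_congr {ι κ : Type*} [Fintype ι] [DecidableEq ι] [Fintype κ] [DecidableEq κ]
    (e : ι ≃ κ) (d : ℕ) : (simplex ι d).card = (simplex κ d).card := by
  refine Finset.card_equiv (Equiv.arrowCongr e (Equiv.refl ℕ)) fun x => ?_
  rw [mem_simplex, mem_simplex]
  simp [Equiv.sum_comp e.symm x]

variable {K : Type*} [Field K] {n : ℕ}

/-- Chinese remainder theorem for the distinct maximal ideals of the points. -/
theorem exists_aeval_eq_ite [IsAlgClosed K] [DecidableEq (Fin n → K)] (T : Finset (Fin n → K)) :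
    ∃ q : T → MvPolynomial (Fin n) K,
      ∀ a b : T, aeval (b : Fin n → K) (q a) = if a = b then (1 : K) else 0 := by
  have hcop : Pairwise (Function.onFun IsCoprime fun b : T =>
      (vanishingIdeal K {(b : Fin n → K)} : Ideal (MvPolynomial (Fin n) K))) := by
    intro b b' hne
    refine Ideal.isCoprime_iff_sup_eq.2
      (Ideal.IsMaximal.coprime_of_ne inferInstance inferInstance fun heq => hne ?_)
    have hmem : ∀ i, X i - C ((b : Fin n → K) i) ∈
        (vanishingIdeal K {(b : Fin n → K)} : Ideal (MvPolynomial (Fin n) K)) := fun i => by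
      rw [mem_vanishingIdeal_singleton_iff]; simp
    apply Subtype.ext
    funext i
    have heq' : (vanishingIdeal K {(b : Fin n → K)} : Ideal (MvPolynomial (Fin n) K)) =
      vanishingIdeal K {(b' : Fin n → K)} := heq
    have := hmem i
    rw [heq', mem_vanishingIdeal_singleton_iff] at this
    simp only [map_sub, aeval_X, algHom_C, Algebra.algebraMap_self, RingHom.id_apply,
      sub_eq_zero] at this
    exact this.symm
  have h := fun a : T => Ideal.exists_forall_sub_mem_ideal hcop
    (fun b => if a = b then (1 : MvPolynomial (Fin n) K) else 0)
  choose q hq using h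
  refine ⟨q, fun a b => ?_⟩
  have := hq a b
  rw [mem_vanishingIdeal_singleton_iff, map_sub, sub_eq_zero] at this
  rw [this]
  split_ifs <;> simp

theorem linearIndependent_mk_of_forall_eq_zero {k : ℕ} {σ S : Type*} [Fintype σ] [CommRing S]
    [Algebra K S] (I : Ideal S) (g : σ → S) (l : σ → Fin k → S)
    (h : ∀ G : σ → MvPolynomial (Fin k) K, ∑ s, g s * aeval (l s) (G s) ∈ I → G = 0) :
    LinearIndependent K fun p : (Fin k → ℕ) × σ =>
      Ideal.Quotient.mk I ((∏ b, l p.2 b ^ p.1 b) * g p.2) := by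
  classical
  rw [linearIndependent_mk_iff]
  intro c hc
  let G : σ → MvPolynomial (Fin k) K := fun s =>
    ∑ p ∈ c.support with p.2 = s, monomial (Finsupp.equivFunOnFinite.symm p.1) (c p)
  have hG : G = 0 := by
    apply h
    convert hc using 1
    rw [Finsupp.linearCombination_apply, Finsupp.sum,
      ← Finset.sum_fiberwise c.support (fun p => p.2)]
    refine Finset.sum_congr rfl fun s _ => ?_
    rw [map_sum, Finset.mul_sum]
    refine Finset.sum_congr rfl fun p hp => ?_
    obtain rfl := (Finset.mem_filter.1 hp).2
    rw [aeval_monomial, Finsupp.prod_fintype _ _ (fun _ => pow_zero _), Algebra.smul_def]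
    simp only [Finsupp.coe_equivFunOnFinite_symm]
    ring
  ext ⟨β, s⟩
  have h1 := congrArg (coeff (Finsupp.equivFunOnFinite.symm β)) (congrFun hG s)
  simp only [G, coeff_sum, coeff_monomial, Pi.zero_apply, coeff_zero,
    EmbeddingLike.apply_eq_iff_eq] at h1
  rw [Finset.sum_filter, Finset.sum_eq_single (β, s)] at h1
  · simpa using h1
  · rintro ⟨β', s'⟩ _ hne
    simp only [ne_eq, Prod.mk.injEq, not_and] at hne
    by_cases hs : s' = s
    · have : β' ≠ β := fun hb => hne hb hs
      simp [hs, this]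
    · simp [hs]
  · intro hnot
    simp [Finsupp.notMem_support_iff.1 hnot]

/-- The products of `F ^ α`, `l s ^ β` and `g s` are linearly independent. Those with `∑ α j * deg
(F j) + ∑ β i ≤ d` have degree at most `d + c`, so they are at most as numerous as the monomials of
that degree. Letting `d` grow removes the shift `c` and leaves the product of degrees. -/
theorem card_le_prod_totalDegree {m k : ℕ} (hn : m + k = n)
    (F : Fin m → MvPolynomial (Fin n) K) (hF : IsRegularFamily F)
    (hdeg : ∀ j, 0 < (F j).totalDegree) {σ : Type*} [Fintype σ]
    (g : σ → MvPolynomial (Fin n) K) (l : σ → Fin k → MvPolynomial (Fin n) K)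
    (hl : ∀ s b, (l s b).totalDegree ≤ 1)
    (h : ∀ G : σ → MvPolynomial (Fin k) K,
      ∑ s, g s * aeval (l s) (G s) ∈ Ideal.span (Set.range F) → G = 0) :
    Fintype.card σ ≤ ∏ j, (F j).totalDegree := by
  classical
  have hind := linearIndependent_prod_pow_mul F hF _
    (linearIndependent_mk_of_forall_eq_zero (Ideal.span (Set.range F)) g l h)
  let c : ℕ := Finset.univ.sup fun s => (g s).totalDegree
  let e : Fin m ⊕ Fin k ≃ Fin n := finSumFinEquiv.trans (finCongr hn)
  refine le_of_mul_le_mul_add (B := fun d => (simplex (Fin m ⊕ Fin k) d).card) (c := c)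
    (fun d => card_simplex_le _ d) (card_simplex_pos _ 0) fun d => ?_
  rw [card_simplex_congr e (d + c)]
  let τ := (weightedSimplex (fun j => (F j).totalDegree) k d) × σ
  let f : τ → (Fin m → ℕ) × ((Fin k → ℕ) × σ) := fun p => (p.1.1.1, p.1.1.2, p.2)
  have hf : Function.Injective f := by
    rintro ⟨⟨⟨a, b⟩, h1⟩, s⟩ ⟨⟨⟨a', b'⟩, h2⟩, s'⟩ heq
    simp only [f, Prod.mk.injEq] at heq
    obtain ⟨rfl, rfl, rfl⟩ := heq
    rfl
  have hcard := card_le_card_simplex (d := d + c) _ (hind.comp f hf) (by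
    rintro ⟨⟨⟨α, β⟩, hab⟩, s⟩
    have hab' : ∑ j, α j * (F j).totalDegree + ∑ i, β i ≤ d := (Finset.mem_filter.1 hab).2
    simp only [Function.comp, f]
    have h1 : (∏ j, F j ^ α j).totalDegree ≤ ∑ j, α j * (F j).totalDegree :=
      (totalDegree_finsetProd _ _).trans (Finset.sum_le_sum fun j _ => totalDegree_pow _ _)
    have h2 : (∏ b, l s b ^ β b).totalDegree ≤ ∑ b, β b :=
      (totalDegree_finsetProd _ _).trans (Finset.sum_le_sum fun b _ =>
        (totalDegree_pow _ _).trans (by simpa using Nat.mul_le_mul_left (β b) (hl s b)))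
    have h3 : (g s).totalDegree ≤ c :=
      Finset.le_sup (f := fun s => (g s).totalDegree) (Finset.mem_univ s)
    have h4 := totalDegree_mul (∏ b, l s b ^ β b) (g s)
    have h5 := totalDegree_mul (∏ j, F j ^ α j) ((∏ b, l s b ^ β b) * g s)
    omega)
  rw [Fintype.card_prod, Fintype.card_coe] at hcard
  have := card_simplex_le_prod_mul (k := k) (fun j => (F j).totalDegree) hdeg d
  calc Fintype.card σ * (simplex (Fin m ⊕ Fin k) d).card
      ≤ Fintype.card σ * ((∏ j, (F j).totalDegree) *
          (weightedSimplex (fun j => (F j).totalDegree) k d).card) := Nat.mul_le_mul_left _ this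
    _ = (∏ j, (F j).totalDegree) *
          ((weightedSimplex (fun j => (F j).totalDegree) k d).card * Fintype.card σ) := by ring
    _ ≤ _ := Nat.mul_le_mul_left _ hcard

/-- A factor `h i` lying in every `Q j` with `j ≠ i` but not in `Q i` isolates the `i`-th component;
the interpolating factors `q i a` then separate the chosen points on it. Existence of `h i` uses
that the primes are incomparable. -/
theorem sum_card_le_prod_totalDegree [IsAlgClosed K] {m k : ℕ} (hn : m + k = n)
    (F : Fin m → MvPolynomial (Fin n) K) (hF : IsRegularFamily F)
    (hdeg : ∀ j, 0 < (F j).totalDegree) {ι : Type*} [Fintype ι]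
    (Q : ι → Ideal (MvPolynomial (Fin n) K)) (hQ : ∀ i, (Q i).IsPrime)
    (hFQ : ∀ i, Ideal.span (Set.range F) ≤ Q i) (hinc : ∀ i j, Q j ≤ Q i → j = i)
    (hht : ∀ i, ∀ M : Ideal (MvPolynomial (Fin n) K ⧸ Q i), M.IsMaximal → (k : ℕ∞) ≤ M.height)
    (l : ι → Fin k → MvPolynomial (Fin n) K) (hl : ∀ i b, (l i b).totalDegree ≤ 1)
    (hfin : ∀ i, (zeroLocus K (Q i ⊔ Ideal.span (Set.range (l i)))).Finite)
    (T : ι → Finset (Fin n → K))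
    (hT : ∀ i, (T i : Set (Fin n → K)) ⊆ zeroLocus K (Q i ⊔ Ideal.span (Set.range (l i)))) :
    ∑ i, (T i).card ≤ ∏ j, (F j).totalDegree := by
  classical
  have hh : ∀ i, ∃ h, (∀ j ≠ i, h ∈ Q j) ∧ h ∉ Q i := by
    intro i
    have hnle : ¬ ∏ j ∈ Finset.univ.erase i, Q j ≤ Q i := by
      intro hle
      obtain ⟨j, hj, hji⟩ := (hQ i).prod_le.1 hle
      exact Finset.ne_of_mem_erase hj (hinc i j hji)
    obtain ⟨h, h1, h2⟩ := SetLike.not_le_iff_exists.1 hnle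
    exact ⟨h, fun j hj => (Ideal.prod_le_inf.trans (Finset.inf_le (by simp [hj]))) h1, h2⟩
  choose h hmem hnot using hh
  choose q hq using fun i => exists_aeval_eq_ite (T i)
  have := card_le_prod_totalDegree hn F hF hdeg (σ := Σ i, T i)
    (fun s => h s.1 * q s.1 s.2) (fun s => l s.1) (fun s b => hl s.1 b) (by
      intro G hG
      have hi : ∀ i, (fun a : T i => G ⟨i, a⟩) = 0 := by
        intro i
        have := hQ i
        refine eq_zero_of_sum_mul_aeval_mem (Q i) (hht i) (l i) (hfin i)
          (fun a : T i => (a : Fin n → K)) (fun a => hT i a.2) (q i) (hq i) _ ?_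
        have h1 := hFQ i hG
        rw [Fintype.sum_sigma, ← Finset.add_sum_erase _ _ (Finset.mem_univ i)] at h1
        have h2 : ∑ j ∈ Finset.univ.erase i, ∑ a : T j, h j * q j a * aeval (l j) (G ⟨j, a⟩) ∈ Q i := by
          refine Submodule.sum_mem _ fun j hj => Submodule.sum_mem _ fun a _ => ?_
          rw [mul_assoc]
          exact Ideal.mul_mem_right _ _ (hmem j i (Finset.ne_of_mem_erase hj).symm)
        have h3 := (Ideal.add_mem_iff_left _ h2).1 h1
        simp only [mul_assoc, ← Finset.mul_sum] at h3
        exact ((hQ i).mem_or_mem h3).resolve_left (hnot i)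
      funext s
      exact congrFun (hi s.1) s.2)
  simpa [Fintype.card_sigma] using this

end Bezout

/-! ### The degree bound for equidimensional zero sets of regular sequences -/

section Degree

/-- Degrees are suprema that might be infinite a priori; testing all finite lower bounds also
excludes this. -/
theorem _root_.ENat.sum_le_of_forall_nat {ι : Type*} (s : Finset ι) (a : ι → ℕ∞) (B : ℕ)
    (h : ∀ N : ι → ℕ, (∀ i ∈ s, (N i : ℕ∞) ≤ a i) → ∑ i ∈ s, N i ≤ B) : ∑ i ∈ s, a i ≤ B := by
  classical
  have hne : ∀ i ∈ s, a i ≠ ⊤ := by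
    intro i hi htop
    have := h (fun j => if j = i then B + 1 else 0) (by
      intro j _
      by_cases hj : j = i
      · rw [hj, htop]; exact le_top
      · simp [hj])
    rw [Finset.sum_ite_eq' s i] at this
    simp [hi] at this
  have h2 := h (fun i => (a i).toNat) (fun i hi => by rw [ENat.natCast_toNat (hne i hi)])
  calc ∑ i ∈ s, a i = ∑ i ∈ s, (((a i).toNat : ℕ) : ℕ∞) :=
        Finset.sum_congr rfl fun i hi => (ENat.natCast_toNat (hne i hi)).symm
    _ = ((∑ i ∈ s, (a i).toNat : ℕ) : ℕ∞) := by push_cast; rfl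
    _ ≤ B := by exact_mod_cast h2

variable {K : Type*} [Field K] {n : ℕ}

theorem exists_equations_affineSubspace {m k : ℕ} (hn : m + k = n)
    (L : AffineSubspace K (Fin n → K)) (hL : Module.finrank K L.direction = m)
    {p : Fin n → K} (hp : p ∈ L) :
    ∃ l : Fin k → MvPolynomial (Fin n) K, (∀ b, (l b).totalDegree ≤ 1) ∧
      ∀ x, x ∈ L ↔ ∀ b, aeval x (l b) = 0 := by
  have hq : Module.finrank K ((Fin n → K) ⧸ L.direction) = Module.finrank K (Fin k → K) := by
    have := Submodule.finrank_quotient_add_finrank L.direction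
    rw [hL] at this
    simp only [Module.finrank_fin_fun] at this ⊢
    omega
  let φ : (Fin n → K) →ₗ[K] (Fin k → K) :=
    (LinearEquiv.ofFinrankEq _ _ hq).toLinearMap ∘ₗ L.direction.mkQ
  have hφ : ∀ v, φ v = 0 ↔ v ∈ L.direction := by
    intro v
    simp [φ]
  refine ⟨fun b => ∑ i, C (φ (Pi.single i 1) b) * X i - C (φ p b), fun b => ?_, fun x => ?_⟩
  · refine (totalDegree_sub_C_le _ _).trans ((totalDegree_finsetSum _ _).trans ?_)
    refine Finset.sup_le fun i _ => (totalDegree_mul _ _).trans ?_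
    rw [totalDegree_C, zero_add]
    exact (totalDegree_X i).le
  · rw [← AffineSubspace.vsub_right_mem_direction_iff_mem hp, ← hφ, vsub_eq_sub, map_sub, sub_eq_zero,
      _root_.funext_iff]
    refine forall_congr' fun b => ?_
    have : φ x b = ∑ i, φ (Pi.single i 1) b * x i := by
      conv_lhs => rw [pi_eq_sum_univ' x]
      simp [Finset.sum_apply, mul_comm]
    simp [this, sub_eq_zero]

theorem degree_le_prod_totalDegree [IsAlgClosed K] {m k : ℕ} (hn : m + k = n)
    (F : Fin m → MvPolynomial (Fin n) K) (hF : IsRegularFamily F)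
    (hdeg : ∀ j, 0 < (F j).totalDegree) {V : Set (Fin n → K)}
    (hV : V = zeroLocus K (Ideal.span (Set.range F)))
    (hdim : ∀ C ∈ components V, dim C = ((k : ℕ) : WithBot ℕ∞))
    (hht : ∀ C ∈ components V, ∀ M : Ideal (MvPolynomial (Fin n) K ⧸ vanishingIdeal K C),
      M.IsMaximal → (k : ℕ∞) ≤ M.height) :
    degree V ≤ ((∏ j, (F j).totalDegree : ℕ) : ℕ∞) := by
  classical
  refine iSup_le fun s => ENat.sum_le_of_forall_nat s _ _ fun N hN => ?_
  -- Components with `N C = 0` are dropped: they require no points, and a positive `N C` is what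
  -- guarantees an affine subspace meeting `C` in at least `N C` points.
  have hdata : ∀ C : {C : components V // C ∈ s.filter fun C => 0 < N C},
      ∃ (l : Fin k → MvPolynomial (Fin n) K) (T : Finset (Fin n → K)),
        (∀ b, (l b).totalDegree ≤ 1) ∧ T.card = N C.1 ∧
        (zeroLocus K (vanishingIdeal K (C.1 : Set (Fin n → K)) ⊔ Ideal.span (Set.range l))).Finite ∧
        (T : Set (Fin n → K)) ⊆
          zeroLocus K (vanishingIdeal K (C.1 : Set (Fin n → K)) ⊔ Ideal.span (Set.range l)) := by
    rintro ⟨C, hC⟩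
    obtain ⟨hCs, hpos⟩ := Finset.mem_filter.1 hC
    have hlt : ((N C - 1 : ℕ) : ℕ∞) < irreducibleDegree (C : Set (Fin n → K)) := by
      refine lt_of_lt_of_le ?_ (hN C hCs)
      exact_mod_cast Nat.sub_lt hpos one_pos
    rw [irreducibleDegree, lt_iSup_iff] at hlt
    obtain ⟨L, hlt⟩ := hlt
    rw [lt_iSup_iff] at hlt
    obtain ⟨hLdim, hlt⟩ := hlt
    rw [lt_iSup_iff] at hlt
    obtain ⟨hLfin, hlt⟩ := hlt
    have hle : ((N C : ℕ) : ℕ∞) ≤ ((C : Set (Fin n → K)) ∩ L).encard := by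
      have := Order.add_one_le_of_lt hlt
      have h1 : ((N C - 1 : ℕ) : ℕ∞) + 1 = N C := by
        exact_mod_cast Nat.sub_add_cancel hpos
      rwa [h1] at this
    obtain ⟨T, hTsub, hTcard⟩ := Set.exists_subset_encard_eq hle
    have hTfin : T.Finite := hLfin.subset hTsub
    have hTne : T.Nonempty := by
      rw [← Set.encard_pos, hTcard]; exact_mod_cast hpos
    obtain ⟨p, hp⟩ := hTne
    have hLm : Module.finrank K L.direction = m := by
      rw [hdim C C.2] at hLdim
      have : Module.finrank K L.direction + k = n := by exact_mod_cast hLdim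
      omega
    obtain ⟨l, hl1, hl2⟩ := exists_equations_affineSubspace hn L hLm (hTsub hp).2
    have hz : zeroLocus K (vanishingIdeal K (C : Set (Fin n → K)) ⊔ Ideal.span (Set.range l)) =
        (C : Set (Fin n → K)) ∩ L := by
      have h1 : zeroLocus K (vanishingIdeal K (C : Set (Fin n → K)) ⊔ Ideal.span (Set.range l)) =
          zeroLocus K (vanishingIdeal K (C : Set (Fin n → K))) ∩
            zeroLocus K (Ideal.span (Set.range l)) :=
        zeroLocus_vanishingIdeal_galoisConnection.l_sup
      rw [h1, C.2.1.1.isVariety.zeroLocus_vanishingIdeal, zeroLocus_span]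
      ext x
      simp [hl2]
    refine ⟨l, hTfin.toFinset, hl1, ?_, hz ▸ hLfin, ?_⟩
    · rw [← Set.ncard_eq_toFinset_card T hTfin, Set.ncard, hTcard]; rfl
    · rw [hz, hTfin.coe_toFinset]; exact hTsub
  choose l T hl hTcard hfin hT using hdata
  have hVvar : IsVariety V := ⟨_, hV⟩
  have hmain := sum_card_le_prod_totalDegree hn F hF hdeg
    (fun C : {C : components V // C ∈ s.filter fun C => 0 < N C} =>
      vanishingIdeal K (C.1 : Set (Fin n → K)))
    (fun C => isPrime_vanishingIdeal C.1.2.1.1)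
    (fun C => by
      rw [← le_zeroLocus_iff_le_vanishingIdeal, ← hV]
      exact C.1.2.1.2)
    (fun C C' hle => by
      have h1 : (C.1 : Set (Fin n → K)) ⊆ C'.1 := by
        rwa [C'.1.2.1.1.isVariety.subset_iff]
      exact Subtype.ext (Subtype.ext (subset_antisymm (C.1.2.2 C'.1.2.1 h1) h1)))
    (fun C => hht C.1 C.1.2) l hl hfin T hT
  simp only [hTcard] at hmain
  have hsum : ∑ C ∈ s, N C = ∑ C : {C : components V // C ∈ s.filter fun C => 0 < N C}, N C.1 := by
    rw [Finset.sum_coe_sort (s.filter fun C => 0 < N C) N]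
    refine (Finset.sum_filter_of_ne fun C _ h => Nat.pos_of_ne_zero h).symm
  rw [hsum]
  exact hmain

end Degree

/-! ### Reducedness of fibres at separable specializations -/

section Radical

/-- Differentiating `g (a i) = 0` gives `g' (a i) • D (a i) = 0`, and separability makes `g' (a i)`
a unit. Thus all differentials vanish. -/
theorem formallyUnramified_of_separable {K A ι : Type*} [Field K] [CommRing A] [Algebra K A]
    (a : ι → A) (ha : Algebra.adjoin K (Set.range a) = ⊤) (g : Polynomial K) (hg : g.Separable)
    (hga : ∀ i, Polynomial.aeval (a i) g = 0) : Algebra.FormallyUnramified K A := by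
  have hD : ∀ i, KaehlerDifferential.D K A (a i) = 0 := by
    intro i
    obtain ⟨u, v, huv⟩ := hg
    have h1 := congrArg (Polynomial.aeval (a i)) huv
    simp only [map_add, map_mul, hga, mul_zero, zero_add, map_one] at h1
    have h2 := (KaehlerDifferential.D K A).map_aeval g (a i)
    rw [hga, map_zero] at h2
    rw [← one_smul A (KaehlerDifferential.D K A (a i)), ← h1, mul_smul, ← h2, smul_zero]
  have hall : ∀ x, KaehlerDifferential.D K A x = 0 := by
    intro x
    have hx : x ∈ Algebra.adjoin K (Set.range a) := ha ▸ Algebra.mem_top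
    have := Derivation.eqOn_adjoin (D1 := KaehlerDifferential.D K A) (D2 := 0)
      (s := Set.range a) (by rintro _ ⟨i, rfl⟩; simpa using hD i) hx
    simpa using this
  have htop : (⊥ : Submodule A (Ω[A⁄K])) = ⊤ := by
    rw [← KaehlerDifferential.span_range_derivation, eq_comm, Submodule.span_eq_bot]
    rintro _ ⟨x, rfl⟩
    exact hall x
  exact ⟨(Submodule.subsingleton_iff A).1 (subsingleton_of_bot_eq_top htop)⟩

variable {K S κ ι : Type*} [Field K] [CommRing S] [Algebra K S]
  [Algebra (MvPolynomial κ K) S] [IsScalarTower K (MvPolynomial κ K) S]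

/-- The fibre over `z` is generated over `K` by roots of the separable polynomial `f.map (eval z)`,
hence unramified and of finite type over a field, hence reduced. -/
theorem isRadical_map_ker_eval [Finite ι] (y : ι → S) (hy : Algebra.adjoin K (Set.range y) = ⊤)
    (f : Polynomial (MvPolynomial κ K)) (hfy : ∀ i, Polynomial.aeval (y i) f = 0)
    (z : κ → K) (hz : (f.map (eval z)).Separable) :
    ((RingHom.ker (eval z)).map (algebraMap (MvPolynomial κ K) S)).IsRadical := by
  set I := (RingHom.ker (eval z)).map (algebraMap (MvPolynomial κ K) S) with hI
  have hcomp : (Ideal.Quotient.mk I).comp (algebraMap (MvPolynomial κ K) S) =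
      (algebraMap K (S ⧸ I)).comp (eval z) := by
    refine RingHom.ext fun p => ?_
    have hp : p - C (eval z p) ∈ RingHom.ker (eval z) := by
      rw [RingHom.mem_ker]; simp
    have h1 := Ideal.mem_map_of_mem (algebraMap (MvPolynomial κ K) S) hp
    rw [map_sub, ← Ideal.Quotient.mk_eq_mk_iff_sub_mem] at h1
    simp only [RingHom.comp_apply]
    rw [h1, ← MvPolynomial.algebraMap_eq, ← IsScalarTower.algebraMap_apply]
    rfl
  have hroot : ∀ i, Polynomial.aeval (Ideal.Quotient.mk I (y i)) (f.map (eval z)) = 0 := by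
    intro i
    rw [Polynomial.aeval_def, Polynomial.eval₂_map, ← hcomp, ← Polynomial.hom_eval₂,
      ← Polynomial.aeval_def, hfy, map_zero]
  have hgen : Algebra.adjoin K (Set.range fun i => Ideal.Quotient.mk I (y i)) = ⊤ := by
    have : (Set.range fun i => Ideal.Quotient.mk I (y i)) =
        Ideal.Quotient.mkₐ K I '' Set.range y := by
      rw [← Set.range_comp]; rfl
    rw [this, ← AlgHom.map_adjoin, hy, Algebra.map_top,
      AlgHom.range_eq_top]
    exact Ideal.Quotient.mkₐ_surjective K I
  have := formallyUnramified_of_separable _ hgen _ hz hroot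
  have : Algebra.FiniteType K (S ⧸ I) := ⟨⟨(Set.finite_range _).toFinset, by simpa using hgen⟩⟩
  rw [Ideal.isRadical_iff_quotient_reduced]
  exact Algebra.FormallyUnramified.isReduced_of_field K (S ⧸ I)

end Radical

/-! ### From generically reduced fibres to a radical ideal -/

section RadicalOfFree

theorem repr_mem_of_mem_map {R S ι : Type*} [CommRing R] [CommRing S] [Algebra R S]
    (b : Module.Basis ι R S) {I : Ideal R} {w : S} (hw : w ∈ I.map (algebraMap R S)) (i : ι) :
    b.repr w i ∈ I := by
  have h : w ∈ I • (⊤ : Submodule R S) := by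
    rw [Ideal.smul_top_eq_map]; exact hw
  refine Submodule.smul_induction_on (p := fun w => b.repr w i ∈ I) h (fun r hr x _ => ?_)
    fun x y hx hy => ?_
  · rw [map_smul, Finsupp.smul_apply, smul_eq_mul]; exact I.mul_mem_right _ hr
  · rw [map_add, Finsupp.add_apply]; exact I.add_mem hx hy

theorem eval_killInl {K ι κ : Type*} [Field K] (t : κ → K) (p : MvPolynomial (ι ⊕ κ) K) :
    eval t (killInl K ι κ p) = eval (Sum.elim 0 t) p := by
  have : ((aeval t : MvPolynomial κ K →ₐ[K] K)).comp (killInl K ι κ) = aeval (Sum.elim 0 t) := by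
    refine MvPolynomial.algHom_ext fun i => ?_
    rcases i with i | i <;> simp [killInl]
  have h := DFunLike.congr_fun this p
  simpa [aeval_eq_eval] using h

variable {K S ι κ τ : Type*} [Field K] [Infinite K] [CommRing S] [Algebra K S]
  [Algebra (MvPolynomial (ι ⊕ κ) K) S] [IsScalarTower K (MvPolynomial (ι ⊕ κ) K) S]

/-- Let `D` be the resultant of `f` and its derivative. If a power of `w` lies in the extended
ideal, then over each point of the slice with `D ≠ 0` the fibre is reduced, so the coordinates of
`w` in the basis vanish there. Hence `D` times each coordinate vanishes on the whole slice; as `D`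
is not identically zero on it, the coordinates themselves restrict to zero. -/
theorem isRadical_map_inlIdeal [Finite τ] {d : ℕ} (b : Module.Basis (Fin d) (MvPolynomial (ι ⊕ κ) K) S)
    (y : τ → S) (hy : Algebra.adjoin K (Set.range y) = ⊤)
    (f : Polynomial (MvPolynomial (ι ⊕ κ) K)) (hf : f.Monic)
    (hfy : ∀ i, Polynomial.aeval (y i) f = 0)
    (t₀ : κ → K) (ht₀ : (f.map (eval (Sum.elim (0 : ι → K) t₀))).Separable)
    (hdeg : f.natDegree ≠ 0) :
    ((inlIdeal K ι κ).map (algebraMap (MvPolynomial (ι ⊕ κ) K) S)).IsRadical := by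
  set D := Polynomial.resultant f (Polynomial.derivative f) with hD
  have hmap : ∀ z : ι ⊕ κ → K, eval z D ≠ 0 → (f.map (eval z)).Separable := by
    intro z hz
    obtain ⟨p, q, -, -, hpq⟩ := Polynomial.exists_mul_add_mul_eq_C_resultant f
      (Polynomial.derivative f) le_rfl le_rfl (Or.inl hdeg)
    have h1 := congrArg (Polynomial.map (eval z)) hpq
    simp only [Polynomial.map_add, Polynomial.map_mul, Polynomial.map_C,
      ← Polynomial.derivative_map] at h1
    refine ⟨Polynomial.C (eval z D)⁻¹ * p.map (eval z), Polynomial.C (eval z D)⁻¹ * q.map (eval z), ?_⟩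
    rw [mul_assoc, mul_assoc, ← mul_add, mul_comm (p.map _), mul_comm (q.map _), h1,
      ← Polynomial.C_mul, inv_mul_cancel₀ hz, Polynomial.C_1]
  -- The degree of the derivative may drop under specialization, for instance in positive
  -- characteristic. The resultant then changes only by a power of the leading coefficient of `f`,
  -- which is 1.
  have hne : eval (Sum.elim (0 : ι → K) t₀) D ≠ 0 := by
    set z : ι ⊕ κ → K := Sum.elim (0 : ι → K) t₀
    have hfz : (f.map (eval z)).Monic := hf.map _
    have hu := (Polynomial.isUnit_resultant_iff_isCoprime hfz).2 ht₀
    have hle : (Polynomial.derivative (f.map (eval z))).natDegree ≤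
        (Polynomial.derivative f).natDegree := by
      rw [Polynomial.derivative_map]; exact Polynomial.natDegree_map_le
    obtain ⟨e, he⟩ := Nat.exists_eq_add_of_le hle
    rw [hD, ← Polynomial.resultant_map_map, he, ← Polynomial.derivative_map,
      Polynomial.resultant_add_right_deg _ _ _ _ _ le_rfl]
    have hn : (f.map (eval z)).natDegree = f.natDegree := hf.natDegree_map _
    rw [← hn, ← Polynomial.leadingCoeff, hfz.leadingCoeff, one_pow, one_mul]
    exact hu.ne_zero
  have hD0 : killInl K ι κ D ≠ 0 := by
    intro h
    apply hne
    rw [← eval_killInl, h, map_zero]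
  intro w hw
  have hcoord : ∀ i, b.repr w i ∈ inlIdeal K ι κ := by
    intro i
    rw [mem_inlIdeal_iff]
    refine (mul_eq_zero.1 ?_).resolve_left hD0
    refine MvPolynomial.funext fun t => ?_
    rw [map_mul, map_zero, eval_killInl, eval_killInl, mul_eq_zero]
    by_cases hz : eval (Sum.elim (0 : ι → K) t) D = 0
    · exact Or.inl hz
    right
    have hrad := isRadical_map_ker_eval y hy f hfy _ (hmap _ hz)
    have hle : inlIdeal K ι κ ≤ RingHom.ker (eval (Sum.elim (0 : ι → K) t)) := by
      intro p hp
      rw [RingHom.mem_ker, ← eval_killInl, (mem_inlIdeal_iff p).1 hp, map_zero]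
    have hwz := hrad (Ideal.radical_mono (Ideal.map_mono hle) hw)
    rw [← RingHom.mem_ker]
    exact repr_mem_of_mem_map b hwz i
  rw [← b.sum_repr w]
  refine Submodule.sum_mem _ fun i _ => ?_
  rw [Algebra.smul_def]
  exact Ideal.mul_mem_right _ _ (Ideal.mem_map_of_mem _ (hcoord i))

end RadicalOfFree

/-! ### Completing linear forms and the generic monic polynomial -/

section GenericPolynomial

open scoped Matrix

theorem exists_completion {K : Type*} [Field K] {m k n : ℕ} (hn : m + k = n)
    (l : Matrix (Fin m) (Fin n) K) (hl : LinearIndependent K l) :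
    ∃ (M : Matrix (Fin m ⊕ Fin k) (Fin n) K) (N : Matrix (Fin n) (Fin m ⊕ Fin k) K),
      M * N = 1 ∧ N * M = 1 ∧ ∀ j, M (Sum.inl j) = l j := by
  classical
  let b := Module.Basis.sumExtend (v := (l : Fin m → Fin n → K)) hl
  have : Finite (Fin m ⊕ Module.Basis.sumExtendIndex hl) := Module.Finite.finite_basis b
  have : Finite (Module.Basis.sumExtendIndex hl) :=
    Finite.of_injective (Sum.inr : _ → Fin m ⊕ Module.Basis.sumExtendIndex hl) Sum.inr_injective
  let _ := Fintype.ofFinite (Module.Basis.sumExtendIndex hl)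
  have hcard : Fintype.card (Module.Basis.sumExtendIndex hl) = k := by
    have h1 := Module.finrank_eq_card_basis b
    rw [Module.finrank_fin_fun, Fintype.card_sum, Fintype.card_fin] at h1
    omega
  let b' := b.reindex (Equiv.sumCongr (Equiv.refl (Fin m)) (Fintype.equivFinOfCardEq hcard))
  let e := Pi.basisFun K (Fin n)
  refine ⟨(e.toMatrix b')ᵀ, (b'.toMatrix e)ᵀ, ?_, ?_, fun j => ?_⟩
  · rw [← Matrix.transpose_mul, b'.toMatrix_mul_toMatrix_flip, Matrix.transpose_one]
  · rw [← Matrix.transpose_mul, e.toMatrix_mul_toMatrix_flip, Matrix.transpose_one]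
  · ext i
    have : b (Sum.inl j) = l j := by
      simp only [b, Module.Basis.sumExtend, Module.Basis.reindex_apply,
        Module.Basis.extend_apply_self]
      rfl
    simp [Module.Basis.toMatrix_apply, e, b', this]

variable {K S ι : Type*} [Field K] [CommRing S] [Algebra K S] [Fintype ι] {n : ℕ}

/-- The algebra homomorphism attached to affine forms `∑ M s k a k + β s` in the elements `a k`. -/
def affineHom (M : Matrix ι (Fin n) K) (β : ι → K) (a : Fin n → S) : MvPolynomial ι K →ₐ[K] S :=
  aeval fun s => ∑ k, M s k • a k + algebraMap K S (β s)

/-- The affine forms `∑ N k s (X s - β s)`. -/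
def affineForm (N : Matrix (Fin n) ι K) (β : ι → K) (k : Fin n) : MvPolynomial ι K :=
  ∑ s, N k s • (X s - C (β s))

/-- The monic polynomial of degree `n` whose lower coefficients are given affine forms. -/
def monicPoly {R : Type*} [CommRing R] (a : Fin n → R) : Polynomial R :=
  Polynomial.X ^ n + ∑ k : Fin n, Polynomial.C (a k) * Polynomial.X ^ (k : ℕ)

theorem map_monicPoly {R R' : Type*} [CommRing R] [CommRing R'] (φ : R →+* R') (a : Fin n → R) :
    (monicPoly a).map φ = monicPoly (fun k => φ (a k)) := by
  simp [monicPoly, Polynomial.map_sum]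

theorem monic_monicPoly {R : Type*} [CommRing R] (a : Fin n → R) : (monicPoly a).Monic :=
  Polynomial.monic_X_pow_add (Polynomial.degree_sum_fin_lt a)

theorem natDegree_monicPoly {R : Type*} [CommRing R] [Nontrivial R] (a : Fin n → R) :
    (monicPoly a).natDegree = n := by
  rw [monicPoly, Polynomial.natDegree_add_eq_left_of_degree_lt]
  · exact Polynomial.natDegree_X_pow n
  · rw [Polynomial.degree_X_pow]; exact Polynomial.degree_sum_fin_lt a

theorem coeff_monicPoly {R : Type*} [CommRing R] (a : Fin n → R) (k : Fin n) :
    (monicPoly a).coeff k = a k := by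
  simp only [monicPoly, Polynomial.coeff_add, Polynomial.coeff_X_pow, Polynomial.finsetSum_coeff,
    Polynomial.coeff_C_mul, Fin.val_inj]
  rw [if_neg k.2.ne]
  simp

theorem monicPoly_coeff {R : Type*} [CommRing R] [Nontrivial R] {g : Polynomial R} (hg : g.Monic)
    (hn : g.natDegree = n) : monicPoly (fun k : Fin n => g.coeff k) = g := by
  conv_rhs => rw [hg.as_sum, hn]
  rw [monicPoly, Fin.sum_univ_eq_sum_range (fun k => Polynomial.C (g.coeff k) * Polynomial.X ^ k) n]

theorem affineHom_affineForm {M : Matrix ι (Fin n) K} {N : Matrix (Fin n) ι K} (h : N * M = 1)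
    (β : ι → K) (a : Fin n → S) (k : Fin n) : affineHom M β a (affineForm N β k) = a k := by
  have h1 : ∀ i, ∑ s, N k s * M s i = if k = i then 1 else 0 := fun i => by
    rw [← Matrix.one_apply, ← h, Matrix.mul_apply]
  simp only [affineForm, map_sum, map_smul, map_sub, affineHom, aeval_X, algHom_C,
    add_sub_cancel_right, Finset.smul_sum, smul_smul]
  rw [Finset.sum_comm]
  simp only [← Finset.sum_smul, h1]
  simp

theorem affineHom_aeval_affineForm {M : Matrix ι (Fin n) K} {N : Matrix (Fin n) ι K}
    [DecidableEq ι] (h : M * N = 1) (β : ι → K) (z : ι → S) :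
    affineHom M β (fun k => aeval z (affineForm N β k)) = aeval z := by
  refine MvPolynomial.algHom_ext fun s => ?_
  have h1 : ∀ i, ∑ k, M s k * N k i = if s = i then 1 else 0 := fun i => by
    rw [← Matrix.one_apply, ← h, Matrix.mul_apply]
  simp only [affineForm, map_sum, map_smul, map_sub, affineHom, aeval_X, algHom_C,
    Finset.smul_sum, smul_smul]
  rw [Finset.sum_comm]
  simp only [← Finset.sum_smul, h1]
  simp

omit [Fintype ι] in
theorem algHom_comp_affineHom {S' : Type*} [CommRing S'] [Algebra K S'] (M : Matrix ι (Fin n) K)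
    (β : ι → K) (a : Fin n → S) (φ : S →ₐ[K] S') :
    φ.comp (affineHom M β a) = affineHom M β (fun k => φ (a k)) := by
  refine MvPolynomial.algHom_ext fun s => ?_
  simp [affineHom]

/-- Adjusting the two lowest coefficients suffices: the linear one makes the derivative nonzero, the
constant one avoids the finitely many critical values. -/
theorem exists_separable_monicPoly [IsAlgClosed K] (hn : 2 ≤ n) (a : Fin n → K) :
    ∃ a' : Fin n → K, (∀ k : Fin n, 2 ≤ (k : ℕ) → a' k = a k) ∧ (monicPoly a').Separable := by
  classical
  have : Infinite K := IsAlgClosed.instInfinite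
  let i0 : Fin n := ⟨0, by omega⟩
  let i1 : Fin n := ⟨1, by omega⟩
  let a0 : Fin n → K := fun k => if 2 ≤ (k : ℕ) then a k else 0
  -- In positive characteristic the derivative may vanish identically; adding `T` then makes it
  -- equal to 1.
  let c1 : K := if (Polynomial.derivative (monicPoly a0)) = 0 then 1 else 0
  let g := monicPoly a0 + Polynomial.C c1 * Polynomial.X
  have hg : Polynomial.derivative g ≠ 0 := by
    simp only [g, c1, Polynomial.derivative_add, Polynomial.derivative_C_mul, Polynomial.derivative_X]
    split_ifs with h
    · rw [h]; simp
    · simpa using h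
  -- With `c0` different from `-g(t)` at every zero `t` of `g'`, the polynomial `g + c0` has no
  -- double root.
  obtain ⟨c0, hc0⟩ := Infinite.exists_notMem_finset
    ((Polynomial.derivative g).roots.toFinset.image fun t => - g.eval t)
  refine ⟨fun k => if 2 ≤ (k : ℕ) then a k else if (k : ℕ) = 1 then c1 else c0,
    fun k hk => if_pos hk, ?_⟩
  have hgc : monicPoly (fun k : Fin n => if 2 ≤ (k : ℕ) then a k else if (k : ℕ) = 1 then c1 else c0)
      = g + Polynomial.C c0 := by
    simp only [g, monicPoly, add_assoc]
    congr 1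
    have h2 : ∑ k : Fin n, Polynomial.C (if (k : ℕ) = 1 then c1 else 0) *
        (Polynomial.X : Polynomial K) ^ (k : ℕ) = Polynomial.C c1 * Polynomial.X := by
      rw [Finset.sum_eq_single i1]
      · simp [i1]
      · intro b _ hb
        have : (b : ℕ) ≠ 1 := fun h => hb (Fin.ext h)
        simp [this]
      · simp
    have h3 : ∑ k : Fin n, Polynomial.C (if (k : ℕ) = 0 then c0 else 0) *
        (Polynomial.X : Polynomial K) ^ (k : ℕ) = Polynomial.C c0 := by
      rw [Finset.sum_eq_single i0]
      · simp [i0]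
      · intro b _ hb
        have : (b : ℕ) ≠ 0 := fun h => hb (Fin.ext h)
        simp [this]
      · simp
    rw [← h2, ← h3, ← Finset.sum_add_distrib, ← Finset.sum_add_distrib]
    refine Finset.sum_congr rfl fun k _ => ?_
    rw [← add_mul, ← add_mul, ← Polynomial.C_add, ← Polynomial.C_add]
    congr 2
    simp only [a0]
    split_ifs <;> first | omega | simp
  rw [hgc, Polynomial.Separable, Polynomial.isCoprime_iff_aeval_ne_zero_of_isAlgClosed K K]
  intro t
  by_contra! h
  obtain ⟨h1, h2⟩ := h
  apply hc0
  simp only [Polynomial.derivative_add, Polynomial.derivative_C, add_zero,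
    Polynomial.coe_aeval_eq_eval, Polynomial.eval_add, Polynomial.eval_C] at h1 h2
  rw [Finset.mem_image]
  refine ⟨t, ?_, ?_⟩
  · rw [Multiset.mem_toFinset, Polynomial.mem_roots hg]; exact h2
  · linear_combination -h1

end GenericPolynomial

/-! ### Factorization into roots; regularity of a sequence of variables -/

theorem exists_eq_prod_X_sub_C {K : Type*} [Field K] [IsAlgClosed K] {n : ℕ} {g : Polynomial K}
    (hg : g.Monic) (hn : g.natDegree = n) :
    ∃ c : Fin n → K, g = ∏ p, (Polynomial.X - Polynomial.C (c p)) := by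
  have hs := IsAlgClosed.splits g
  have hcard : Multiset.card g.roots = n := by rw [← hn, ← hs.natDegree_eq_card_roots]
  have hex : ∃ c : Fin n → K, g.roots = (Finset.univ : Finset (Fin n)).val.map c := by
    obtain ⟨L, hL⟩ := Quot.exists_rep g.roots
    have hL' : (L : Multiset K) = g.roots := hL
    rw [← hL'] at hcard ⊢
    rw [Multiset.coe_card] at hcard
    subst hcard
    exact ⟨L.get, by rw [Fin.univ_val_map, List.ofFn_get]⟩
  obtain ⟨c, hc⟩ := hex
  refine ⟨c, ?_⟩
  conv_lhs => rw [hs.eq_prod_roots_of_monic hg, hc, Multiset.map_map]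
  rfl

theorem isRegularFamily_X_inl (K : Type*) [Field K] (m : ℕ) (κ : Type*) :
    IsRegularFamily fun j : Fin m => (X (Sum.inl j) : MvPolynomial (Fin m ⊕ κ) K) := by
  intro i x hx
  have himg : (fun j : Fin m => (X (Sum.inl j) : MvPolynomial (Fin m ⊕ κ) K)) '' Set.Iio i =
      X '' (Sum.inl '' Set.Iio i) := by rw [Set.image_image]
  rw [himg, mem_ideal_span_X_image] at hx ⊢
  intro d hd
  obtain ⟨s, hs, hds⟩ := hx (Finsupp.single (Sum.inl i) 1 + d) (by
    rw [mem_support_iff, coeff_X_mul]; exact mem_support_iff.1 hd)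
  refine ⟨s, hs, ?_⟩
  obtain ⟨j, hj, rfl⟩ := hs
  have : (Sum.inl i : Fin m ⊕ κ) ≠ Sum.inl j := fun h => (Sum.inl_injective h ▸ hj : j < j).false
  rwa [Finsupp.add_apply, Finsupp.single_eq_of_ne' this, zero_add] at hds

theorem isRegular_X_inl (K : Type*) [Field K] (m : ℕ) (κ : Type*) :
    RingTheory.Sequence.IsRegular (MvPolynomial (Fin m ⊕ κ) K)
      (List.ofFn fun j : Fin m => (X (Sum.inl j) : MvPolynomial (Fin m ⊕ κ) K)) := by
  refine ⟨(isWeaklyRegular_ofFn_iff _).2 (isRegularFamily_X_inl K m κ), ?_⟩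
  rw [smul_eq_mul, Ideal.mul_top]
  intro h
  have h1 : (1 : MvPolynomial (Fin m ⊕ κ) K) ∈ inlIdeal K (Fin m) κ := by
    have : inlIdeal K (Fin m) κ = ⊤ := by
      rw [h, Ideal.ofList, inlIdeal]
      congr 1
      ext x
      simp [List.mem_ofFn, eq_comm]
    rw [this]; trivial
  rw [mem_inlIdeal_iff, map_one] at h1
  exact one_ne_zero h1

/-! ### Regularity, radicality and equidimensionality of the family -/

section Structure

variable {K : Type*} [Field K] [IsAlgClosed K] {m k n : ℕ}

/-- The map `ψ` makes `K[X]` a finite free algebra over a polynomial ring whose first `m` variables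
go to the `R j`. The three claims are then transferred from the coordinate ideal of those variables.
The hypothesis `hl0` serves radicality: it keeps the two lowest coefficients free. -/
theorem regular_radical_equidimensional (hn : m + k = n) (hn2 : 2 ≤ n)
    (τ : MvPolynomial (Fin n) K ≃ₐ[K] MvPolynomial (Fin n) K)
    (a : Fin n → MvPolynomial (Fin n) K)
    (ha : ∀ i : Fin n, a i = (∏ p, (Polynomial.X - Polynomial.C (τ (X p)))).coeff i)
    (l : Matrix (Fin m) (Fin n) K) (hl : LinearIndependent K l)
    (hl0 : ∀ j (i : Fin n), (i : ℕ) < 2 → l j i = 0) (α : Fin m → K)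
    (R : Fin m → MvPolynomial (Fin n) K)
    (hR : ∀ j, R j = ∑ i, l j i • a i + C (α j)) :
    RingTheory.Sequence.IsRegular (MvPolynomial (Fin n) K) (List.ofFn R) ∧
    (Ideal.span (Set.range R)).IsRadical ∧
    ∀ q ∈ (Ideal.span (Set.range R)).minimalPrimes,
      (∀ M : Ideal (MvPolynomial (Fin n) K ⧸ q), M.IsMaximal → M.height = (k : ℕ∞)) ∧
      ringKrullDim (MvPolynomial (Fin n) K ⧸ q) = (k : WithBot ℕ∞) := by
  classical
  obtain ⟨M, N, hMN, hNM, hM⟩ := exists_completion hn l hl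
  let β : Fin m ⊕ Fin k → K := Sum.elim α 0
  let y : Fin n → MvPolynomial (Fin n) K := fun p => τ (X p)
  let ψ := affineHom M β a
  let f := monicPoly (affineForm N β)
  have hψa : ∀ i, ψ (affineForm N β i) = a i := affineHom_affineForm hNM β a
  have hprod : (∏ p, (Polynomial.X - Polynomial.C (y p))) = monicPoly a := by
    have h1 : (∏ p, (Polynomial.X - Polynomial.C (y p))).Monic :=
      Polynomial.monic_prod_of_monic _ _ fun p _ => Polynomial.monic_X_sub_C _
    rw [← monicPoly_coeff (n := n) h1 (by simp)]
    congr 1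
    ext1 i
    exact (ha i).symm
  have hψf : f.map ψ.toRingHom = ∏ p, (Polynomial.X - Polynomial.C (y p)) := by
    rw [hprod, map_monicPoly]
    congr 1
    ext1 i
    exact hψa i
  have hψR : ∀ j, ψ (X (Sum.inl j)) = R j := by
    intro j
    simp [ψ, affineHom, hR, hM, β, algebraMap_eq]
  have hpt : ∀ c : Fin n → K, ∃ φ : MvPolynomial (Fin n) K →ₐ[K] K, ∀ p, φ (y p) = c p := by
    intro c
    refine ⟨(aeval c).comp τ.symm.toAlgHom, fun p => ?_⟩
    simp [y]
  -- Every point of the base lifts: factor the specialized polynomial over `K` and send the `y p` to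
  -- its roots. Injectivity of `ψ`, that is, algebraic independence of the coefficients, follows
  -- because `K` is infinite.
  have hlift : ∀ z : Fin m ⊕ Fin k → K, ∃ φ : MvPolynomial (Fin n) K →ₐ[K] K,
      φ.comp ψ = aeval z := by
    intro z
    obtain ⟨c, hc⟩ := exists_eq_prod_X_sub_C
      (monic_monicPoly fun i => aeval z (affineForm N β i)) (natDegree_monicPoly _)
    obtain ⟨φ, hφ⟩ := hpt c
    refine ⟨φ, ?_⟩
    rw [algHom_comp_affineHom, ← affineHom_aeval_affineForm hMN β z]
    congr 1
    ext1 i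
    have h1 := congrArg (Polynomial.map φ.toRingHom) hprod
    rw [Polynomial.map_prod, map_monicPoly] at h1
    simp only [Polynomial.map_sub, Polynomial.map_X, Polynomial.map_C] at h1
    have h2 : monicPoly (fun i => φ (a i)) = monicPoly fun i => aeval z (affineForm N β i) := by
      rw [hc, ← funext hφ]; exact h1.symm
    have h3 := congrArg (fun g => Polynomial.coeff g i) h2
    simpa only [coeff_monicPoly] using h3
  have hinj : Function.Injective ψ := by
    rw [injective_iff_map_eq_zero]
    intro p hp
    refine MvPolynomial.funext fun z => ?_
    obtain ⟨φ, hφ⟩ := hlift z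
    have h1 := DFunLike.congr_fun hφ p
    rw [AlgHom.comp_apply, hp, map_zero] at h1
    rw [map_zero, ← aeval_eq_eval]
    exact h1.symm
  let _ : Algebra (MvPolynomial (Fin m ⊕ Fin k) K) (MvPolynomial (Fin n) K) :=
    ψ.toRingHom.toAlgebra
  have hmapψ : ∀ p, algebraMap (MvPolynomial (Fin m ⊕ Fin k) K) (MvPolynomial (Fin n) K) p = ψ p :=
    fun _ => rfl
  have : IsScalarTower K (MvPolynomial (Fin m ⊕ Fin k) K) (MvPolynomial (Fin n) K) :=
    IsScalarTower.of_algebraMap_eq fun r => by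
      rw [hmapψ, AlgHom.commutes]
  have hgenK : Algebra.adjoin K (Set.range y) = ⊤ := by
    have : Set.range y = τ.toAlgHom '' Set.range X := by rw [← Set.range_comp]; rfl
    rw [this, ← AlgHom.map_adjoin, adjoin_range_X, Algebra.map_top, AlgHom.range_eq_top]
    exact τ.surjective
  have hgen : Algebra.adjoin (MvPolynomial (Fin m ⊕ Fin k) K) (Set.range y) = ⊤ := by
    rw [eq_top_iff]
    intro x _
    have hx : x ∈ Algebra.adjoin K (Set.range y) := hgenK ▸ Algebra.mem_top
    have h1 : Algebra.adjoin K (Set.range y) ≤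
        (Algebra.adjoin (MvPolynomial (Fin m ⊕ Fin k) K) (Set.range y)).restrictScalars K :=
      Algebra.adjoin_le Algebra.subset_adjoin
    exact h1 hx
  have hyinj : Function.Injective y := τ.injective.comp X_injective
  -- Permuting the `y p` fixes the coefficients of their product polynomial, hence the whole image
  -- of `ψ`.
  have hswap : ∀ i j, ∃ σ : MvPolynomial (Fin n) K →ₐ[MvPolynomial (Fin m ⊕ Fin k) K]
      MvPolynomial (Fin n) K, ∀ p, σ (y p) = y (Equiv.swap i j p) := by
    intro i j
    let σ : MvPolynomial (Fin n) K →ₐ[K] MvPolynomial (Fin n) K :=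
      (τ.toAlgHom.comp (rename (Equiv.swap i j))).comp τ.symm.toAlgHom
    have hσ : ∀ p, σ (y p) = y (Equiv.swap i j p) := fun p => by simp [σ, y]
    have hσa : ∀ i, σ (a i) = a i := by
      have h1 := congrArg (Polynomial.map σ.toRingHom) hprod
      rw [Polynomial.map_prod, map_monicPoly] at h1
      have h2 : ∏ p, Polynomial.map σ.toRingHom (Polynomial.X - Polynomial.C (y p)) =
          ∏ p, (Polynomial.X - Polynomial.C (y p)) := by
        refine Fintype.prod_equiv (Equiv.swap i j) _ _ fun p => ?_
        rw [Polynomial.map_sub, Polynomial.map_X, Polynomial.map_C, ← hσ]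
        rfl
      intro i
      rw [h2, hprod] at h1
      have h3 := congrArg (fun g => Polynomial.coeff g i) h1
      simp only [coeff_monicPoly] at h3
      exact h3.symm
    have hσψ : σ.comp ψ = ψ := by
      rw [algHom_comp_affineHom]
      simp only [hσa]
      rfl
    exact ⟨{ σ with commutes' := fun p => DFunLike.congr_fun hσψ p }, hσ⟩
  obtain ⟨d, ⟨b⟩⟩ := exists_basis_of_swap y hyinj hinj hgen f hψf hswap
  have := Module.Free.of_basis b
  have := Module.Finite.of_basis b
  have : Algebra.IsIntegral (MvPolynomial (Fin m ⊕ Fin k) K) (MvPolynomial (Fin n) K) := inferInstance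
  have hspan : (inlIdeal K (Fin m) (Fin k)).map
      (algebraMap (MvPolynomial (Fin m ⊕ Fin k) K) (MvPolynomial (Fin n) K)) =
      Ideal.span (Set.range R) := by
    rw [inlIdeal, Ideal.map_span, ← Set.range_comp]
    congr 2
    ext1 j
    exact hψR j
  refine ⟨?_, ?_, ?_⟩
  · have := (isRegular_X_inl K m (Fin k)).of_faithfullyFlat (S := MvPolynomial (Fin n) K)
    rw [List.map_ofFn] at this
    have hR' : R = algebraMap (MvPolynomial (Fin m ⊕ Fin k) K) (MvPolynomial (Fin n) K) ∘
        fun j => X (Sum.inl j) := _root_.funext fun j => (hψR j).symm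
    rw [hR']
    exact this
  -- Start from the coefficients at the origin of the base and alter only those of index 0 and 1.
  -- The first `m` affine forms do not involve them, so the new point `z` stays in the slice.
  · obtain ⟨a', ha', hsep⟩ := exists_separable_monicPoly hn2
      (fun i => aeval (0 : Fin m ⊕ Fin k → K) (affineForm N β i))
    let z : Fin m ⊕ Fin k → K := fun s => affineHom M β a' (X s)
    have hz : z = Sum.elim (0 : Fin m → K) (fun s => z (Sum.inr s)) := by
      ext s
      rcases s with j | s
      · have h1 := DFunLike.congr_fun (affineHom_aeval_affineForm hMN β (0 : Fin m ⊕ Fin k → K))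
          (X (Sum.inl j))
        have h2 : affineHom M β a' (X (Sum.inl j)) = affineHom M β
            (fun i => aeval (0 : Fin m ⊕ Fin k → K) (affineForm N β i)) (X (Sum.inl j)) := by
          simp only [affineHom, aeval_X, hM]
          congr 1
          refine Finset.sum_congr rfl fun i _ => ?_
          rcases lt_or_ge (i : ℕ) 2 with hi | hi
          · rw [hl0 j i hi, zero_smul, zero_smul]
          · rw [ha' i hi]
        simp only [z, Sum.elim_inl, Pi.zero_apply]
        rw [h2, h1]; simp
      · rfl
    have hzf : f.map (eval (Sum.elim (0 : Fin m → K) fun s => z (Sum.inr s))) = monicPoly a' := by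
      rw [← hz, map_monicPoly]
      congr 1
      ext1 i
      have h1 : affineHom M β a' = aeval z := MvPolynomial.algHom_ext fun s => by simp [z]
      rw [← affineHom_affineForm hNM β a' i, h1, aeval_eq_eval]
    rw [← hspan]
    refine isRadical_map_inlIdeal b y hgenK f (monic_monicPoly _) (fun p => ?_) _ (hzf ▸ hsep) ?_
    · rw [Polynomial.aeval_def, ← Polynomial.eval_map]
      have h1 : f.map (algebraMap (MvPolynomial (Fin m ⊕ Fin k) K) (MvPolynomial (Fin n) K)) =
        ∏ p, (Polynomial.X - Polynomial.C (y p)) := hψf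
      rw [h1, Polynomial.eval_prod]
      exact Finset.prod_eq_zero (Finset.mem_univ p) (by simp)
    · rw [natDegree_monicPoly]; omega
  · intro q hq
    rw [← hspan] at hq
    simpa using equidimensional_of_mem_minimalPrimes q hq

end Structure

/-! ### Invertible systems of linear forms -/

section LinearForms

theorem eq_sum_of_isHomogeneous_one {R σ : Type*} [CommRing R] [Fintype σ] {p : MvPolynomial σ R}
    (hp : p.IsHomogeneous 1) : p = ∑ i, C (coeff (Finsupp.single i 1) p) * X i := by
  classical
  ext d
  simp only [coeff_sum, coeff_C_mul, coeff_X, mul_ite, mul_one, mul_zero]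
  by_cases hd : d.degree = 1
  · obtain ⟨i, rfl⟩ := (Finsupp.sum_eq_one_iff d).1 hd
    rw [Finset.sum_eq_single i]
    · simp
    · intro j _ hj
      rw [if_neg]
      exact fun h => hj (Finsupp.single_left_injective one_ne_zero h)
    · simp
  · rw [hp.coeff_eq_zero hd, Finset.sum_eq_zero]
    intro i _
    rw [if_neg]
    rintro rfl
    simp at hd

variable {K : Type*} [Field K] {n : ℕ}

/-- The linear map of `Kⁿ` given by `n` linear forms. -/
def evalLinearForms (y : Fin n → MvPolynomial (Fin n) K) : (Fin n → K) →ₗ[K] (Fin n → K) :=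
  (Matrix.of fun p i => coeff (Finsupp.single i 1) (y p)).mulVecLin

theorem evalLinearForms_apply {y : Fin n → MvPolynomial (Fin n) K}
    (hy : ∀ p, (y p).IsHomogeneous 1) (x : Fin n → K) (p : Fin n) :
    evalLinearForms y x p = aeval x (y p) := by
  conv_rhs => rw [eq_sum_of_isHomogeneous_one (hy p)]
  simp [evalLinearForms, Matrix.mulVec, dotProduct]

theorem exists_algEquiv_of_isHomogeneous_one {y : Fin n → MvPolynomial (Fin n) K}
    (hy : ∀ p, (y p).IsHomogeneous 1) (hinj : Function.Injective (evalLinearForms y)) :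
    ∃ τ : MvPolynomial (Fin n) K ≃ₐ[K] MvPolynomial (Fin n) K, ∀ p, τ (X p) = y p := by
  classical
  let A : Matrix (Fin n) (Fin n) K := Matrix.of fun p i => coeff (Finsupp.single i 1) (y p)
  have hA : IsUnit A := Matrix.mulVec_injective_iff_isUnit.1 hinj
  have hdet : IsUnit A.det := (Matrix.isUnit_iff_isUnit_det A).1 hA
  let φ : Matrix (Fin n) (Fin n) K → MvPolynomial (Fin n) K →ₐ[K] MvPolynomial (Fin n) K :=
    fun B => aeval fun p => ∑ i, C (B p i) * X i
  have hφ : ∀ B B', B * B' = 1 → (φ B').comp (φ B) = AlgHom.id K _ := by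
    intro B B' h
    refine MvPolynomial.algHom_ext fun p => ?_
    have h1 : ∀ i, ∑ j, B p j * B' j i = if p = i then 1 else 0 := fun i => by
      rw [← Matrix.one_apply, ← h, Matrix.mul_apply]
    simp only [φ, AlgHom.comp_apply, aeval_X, map_sum, map_mul, algHom_C, algebraMap_eq,
      Finset.mul_sum, AlgHom.id_apply]
    rw [Finset.sum_comm]
    simp only [← mul_assoc, ← C_mul, ← Finset.sum_mul, ← map_sum, h1]
    simp
  refine ⟨AlgEquiv.ofAlgHom (φ A) (φ A⁻¹) (hφ _ _ (Matrix.nonsing_inv_mul A hdet))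
    (hφ _ _ (Matrix.mul_nonsing_inv A hdet)), fun p => ?_⟩
  rw [AlgEquiv.ofAlgHom_apply, aeval_X]
  exact (eq_sum_of_isHomogeneous_one (hy p)).symm

end LinearForms

/-! ### Moore matrices and invertibility of the forms `Y` -/

section Moore

variable {F K : Type*} [Field F] [Fintype F] [Field K] [Algebra F K]

theorem frobenius_pow_sum {ι : Type*} (s : Finset ι) (a : ι → F) (w : ι → K) (k : ℕ) :
    (∑ h ∈ s, a h • w h) ^ Fintype.card F ^ k = ∑ h ∈ s, a h • w h ^ Fintype.card F ^ k := by
  have h1 : ∀ x : K, ((FiniteField.frobeniusAlgHom F K) ^ k) x = x ^ Fintype.card F ^ k := by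
    intro x
    induction k generalizing x with
    | zero => simp
    | succ k ih =>
      rw [pow_succ, AlgHom.mul_apply, ih, FiniteField.frobeniusAlgHom_apply, ← pow_mul, pow_succ']
  simp only [← h1, map_sum, map_smul]

/-- With `q = #F`, the polynomial `∑ c k T ^ (q ^ k)` is additive and `F`-linear, so it vanishes on
the whole `F`-span of `w`. That span has `q ^ i` elements while the degree is at most `q ^ (i - 1)`.
-/
theorem eq_zero_of_sum_mul_pow_card_pow_eq_zero {i : ℕ} {w : Fin i → K}
    (hw : LinearIndependent F w) (c : Fin i → K)
    (h : ∀ j, ∑ k, c k * w j ^ Fintype.card F ^ (k : ℕ) = 0) : c = 0 := by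
  classical
  rcases Nat.eq_zero_or_pos i with rfl | hi
  · exact Subsingleton.elim _ _
  have hq : 1 < Fintype.card F := Fintype.one_lt_card
  let P : Polynomial K := ∑ k : Fin i, Polynomial.C (c k) * Polynomial.X ^ Fintype.card F ^ (k : ℕ)
  have hP : P = 0 := by
    refine Polynomial.eq_zero_of_natDegree_lt_card_of_eval_eq_zero P
      (f := fun a : Fin i → F => ∑ j, a j • w j) ?_ ?_ ?_
    · exact linearIndependent_iff_injective_fintypeLinearCombination.1 hw
    · intro a
      simp only [P, Polynomial.eval_finsetSum, Polynomial.eval_mul, Polynomial.eval_C,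
        Polynomial.eval_pow, Polynomial.eval_X, frobenius_pow_sum, Finset.mul_sum]
      rw [Finset.sum_comm]
      refine Finset.sum_eq_zero fun j _ => ?_
      simp only [mul_smul_comm]
      rw [← Finset.smul_sum, h, smul_zero]
    · rw [Fintype.card_fun, Fintype.card_fin]
      refine lt_of_le_of_lt (Polynomial.natDegree_sum_le_of_forall_le _ _
        (n := Fintype.card F ^ (i - 1)) fun k _ => ?_) (Nat.pow_lt_pow_right hq (by omega))
      refine (Polynomial.natDegree_C_mul_X_pow_le _ _).trans ?_
      exact Nat.pow_le_pow_right (by omega) (by have := k.2; omega)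
  ext k
  have h1 := congrArg (fun P => Polynomial.coeff P (Fintype.card F ^ (k : ℕ))) hP
  simp only [P, Polynomial.finsetSum_coeff, Polynomial.coeff_C_mul, Polynomial.coeff_X_pow,
    Polynomial.coeff_zero] at h1
  rw [Finset.sum_eq_single k] at h1
  · simpa using h1
  · intro j _ hj
    rw [if_neg, mul_zero]
    exact fun h => hj (Fin.ext (Nat.pow_right_injective hq h.symm))
  · simp

theorem eq_zero_of_moore_mulVec {i : ℕ} {w : Fin i → K}
    (hw : LinearIndependent F w) (v : Fin i → K)
    (h : ∀ k : Fin i, ∑ j, w j ^ Fintype.card F ^ (k : ℕ) * v j = 0) : v = 0 := by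
  classical
  by_contra hv
  obtain ⟨c, hc, hc0⟩ := Matrix.exists_vecMul_eq_zero_iff.2
    (Matrix.exists_mulVec_eq_zero_iff.1 ⟨v, hv, _root_.funext h⟩ :
      (Matrix.of fun k j : Fin i => w j ^ Fintype.card F ^ (k : ℕ)).det = 0)
  exact hc (eq_zero_of_sum_mul_pow_card_pow_eq_zero hw c fun j => congrFun hc0 j)

omit [Algebra F K] in
theorem isHomogeneous_linearFormY {n : ℕ} (c : Composition n) (θ : ℕ → K) (p : Fin n) :
    (linearFormY F c θ p).IsHomogeneous 1 :=
  IsHomogeneous.sum _ _ _ fun _ _ => isHomogeneous_C_mul_X _ _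

/-- The forms are block diagonal, and the block of length `i` is the Moore matrix of the conjugates
of the normal element `θ i`. -/
theorem injective_evalLinearForms_linearFormY {n : ℕ} (c : Composition n) (θ : ℕ → K)
    (hθ : ∀ i ∈ Finset.Icc 1 n, IsNormalElement F i (θ i)) :
    Function.Injective (evalLinearForms (linearFormY F c θ)) := by
  rw [injective_iff_map_eq_zero]
  intro v hv
  have h1 : ∀ p, aeval v (linearFormY F c θ p) = 0 := fun p => by
    rw [← evalLinearForms_apply (isHomogeneous_linearFormY c θ), hv]; rfl
  have h2 : ∀ b : Fin c.length, (fun h => v (c.embedding b h)) = 0 := by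
    intro b
    have hN := hθ (c.blocksFun b) (Finset.mem_Icc.2 ⟨c.one_le_blocksFun b, c.blocksFun_le b⟩)
    refine eq_zero_of_moore_mulVec hN.linearIndependent _ fun k => ?_
    -- Generalizing the block index allows rewriting along `index_embedding`, on which the summation
    -- range depends.
    have key : ∀ (b' : Fin c.length) (k' : ℕ), b' = b → k' = k →
        (∑ h : Fin (c.blocksFun b'), (θ (c.blocksFun b') ^ Fintype.card F ^ (h : ℕ)) ^
          Fintype.card F ^ k' * v (c.embedding b' h)) = 0 →
        ∑ h : Fin (c.blocksFun b), (θ (c.blocksFun b) ^ Fintype.card F ^ (h : ℕ)) ^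
          Fintype.card F ^ (k : ℕ) * v (c.embedding b h) = 0 := by
      rintro _ _ rfl rfl h; exact h
    refine key _ _ (c.index_embedding b k) (c.invEmbedding_comp b k) ?_
    have h3 := h1 (c.embedding b k)
    simpa only [linearFormY, map_sum, map_mul, algHom_C, aeval_X, Algebra.algebraMap_self,
      RingHom.id_apply] using h3
  ext p
  rw [← c.embedding_comp_inv p]
  exact congrFun (h2 (c.index p)) (c.invEmbedding p)

end Moore

/-! ### The Jacobian matrix and the number of distinct coordinates -/

section CoefficientForms

/-- The coefficient matrix of a family of linear forms in `A_r, …, A_{n-1}`, as forms in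
`A_0, …, A_{n-1}`. -/
def coeffMatrix {F : Type*} [Field F] {m n r : ℕ} (L : Fin m → MvPolynomial (Set.Ico r n) F) :
    Matrix (Fin m) (Fin n) F :=
  Matrix.of fun j i => if h : r ≤ (i : ℕ) then coeff (Finsupp.single ⟨i, h, i.2⟩ 1) (L j) else 0

theorem sum_Ico_eq_sum_fin {M : Type*} [AddCommMonoid M] {n r : ℕ} (g : Set.Ico r n → M) :
    ∑ k, g k = ∑ i : Fin n, if h : r ≤ (i : ℕ) then g ⟨i, h, i.2⟩ else 0 := by
  refine Fintype.sum_of_injective (fun k : Set.Ico r n => (⟨k, k.2.2⟩ : Fin n)) ?_ _ _ ?_ ?_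
  · intro a b h
    exact Subtype.ext (Fin.mk.inj h)
  · intro i hi
    rw [dif_neg]
    exact fun h => hi ⟨⟨i, h, i.2⟩, rfl⟩
  · intro k
    rw [dif_pos k.2.1]

theorem coeff_prod_X_sub_C {R S : Type*} [CommRing R] [CommRing S] [Algebra R S] {n : ℕ}
    (y : Fin n → S) (i : Fin n) :
    (∏ p, (Polynomial.X - Polynomial.C (y p))).coeff i =
      (-1) ^ (n - (i : ℕ)) * aeval y (esymm (Fin n) R (n - (i : ℕ))) := by
  have h := Multiset.prod_X_sub_C_coeff ((Finset.univ : Finset (Fin n)).val.map y) (k := i)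
    (by simp [i.2.le])
  rw [Multiset.map_map] at h
  rw [aeval_esymm_eq_multiset_esymm]
  simp only [Multiset.card_map, Finset.card_val, Finset.card_univ, Fintype.card_fin] at h
  exact h

variable {F : Type*} [Field F] {m n r : ℕ} {L : Fin m → MvPolynomial (Set.Ico r n) F}

/-- By Vieta, the element substituted for `A_k` is the coefficient of `T ^ k` in `∏ (T - Y p)`. -/
theorem polyInY_eq (hL : ∀ j, (L j).IsHomogeneous 1) (α : F) (j : Fin m) :
    polyInY (L j) α = ∑ i, coeffMatrix L j i •
      (∏ p, (Polynomial.X - Polynomial.C (X p : MvPolynomial (Fin n) F))).coeff i + C α := by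
  rw [polyInY]
  congr 1
  conv_lhs => rw [eq_sum_of_isHomogeneous_one (hL j)]
  rw [map_sum, sum_Ico_eq_sum_fin]
  refine Finset.sum_congr rfl fun i _ => ?_
  simp only [coeffMatrix, Matrix.of_apply]
  split_ifs with h
  · rw [coeff_prod_X_sub_C (R := F), aeval_X_left_apply, map_mul, aeval_X, algHom_C,
      ← Algebra.smul_def]
  · rw [zero_smul]

theorem linearIndependent_coeffMatrix (hL : ∀ j, (L j).IsHomogeneous 1)
    (hLind : LinearIndependent F L) : LinearIndependent F (coeffMatrix L) := by
  rw [Fintype.linearIndependent_iff] at hLind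
  refine Fintype.linearIndependent_iff.2 fun g hg => hLind g ?_
  have h1 : ∀ j, L j = ∑ i, C (coeff (Finsupp.single i 1) (L j)) * X i :=
    fun j => eq_sum_of_isHomogeneous_one (hL j)
  calc ∑ j, g j • L j = ∑ j, g j • ∑ i, C (coeff (Finsupp.single i 1) (L j)) * X i :=
        Finset.sum_congr rfl fun j _ => by rw [← h1]
    _ = ∑ i : Set.Ico r n, (∑ j, g j * coeff (Finsupp.single i 1) (L j)) • X i := by
        simp only [Finset.smul_sum, Finset.sum_smul, ← smul_eq_C_mul, smul_smul]
        rw [Finset.sum_comm]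
    _ = 0 := by
        refine Finset.sum_eq_zero fun i _ => ?_
        have h2 := congrFun hg ⟨i, i.2.2⟩
        rw [Finset.sum_apply] at h2
        simp only [Pi.smul_apply, coeffMatrix, Matrix.of_apply, dif_pos i.2.1, smul_eq_mul,
          Pi.zero_apply] at h2
        rw [h2, zero_smul]

/-- A right inverse over `F` remains a right inverse over `K`. -/
theorem linearIndependent_map_algebraMap {K : Type*} [Field K] [Algebra F K]
    {l : Matrix (Fin m) (Fin n) F} (hl : LinearIndependent F l) :
    LinearIndependent K (l.map (algebraMap F K)) := by
  classical
  have hmn : m ≤ n := by simpa using hl.fintype_card_le_finrank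
  obtain ⟨M, N, hMN, -, hM⟩ := exists_completion (k := n - m) (by omega) l hl
  refine Fintype.linearIndependent_iff.2 fun g hg j => ?_
  have h1 : ∀ j', ∑ i, algebraMap F K (l j' i) * algebraMap F K (N i (Sum.inl j)) =
      if j' = j then 1 else 0 := by
    intro j'
    have h2 := congrFun (congrFun hMN (Sum.inl j')) (Sum.inl j)
    rw [Matrix.mul_apply, hM, Matrix.one_apply] at h2
    simp only [Sum.inl.injEq] at h2
    simp only [← map_mul, ← map_sum, h2]
    split_ifs <;> simp
  have h3 : ∑ i, (∑ j', g j' • (l.map (algebraMap F K)) j') i * algebraMap F K (N i (Sum.inl j)) = 0 := by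
    rw [hg]; simp
  simp only [Finset.sum_apply, Pi.smul_apply, Matrix.map_apply, smul_eq_mul, Finset.sum_mul,
    mul_assoc] at h3
  rw [Finset.sum_comm] at h3
  simp only [← Finset.mul_sum, h1] at h3
  simpa using h3

theorem aeval_polyInY {S : Type*} [CommRing S] [Algebra F S] (hL : ∀ j, (L j).IsHomogeneous 1)
    (α : F) (y : Fin n → S) (j : Fin m) :
    aeval y (polyInY (L j) α) = ∑ i, coeffMatrix L j i •
      (∏ p, (Polynomial.X - Polynomial.C (y p))).coeff i + algebraMap F S α := by
  rw [polyInY_eq hL, map_add, map_sum, algHom_C]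
  congr 1
  refine Finset.sum_congr rfl fun i _ => ?_
  rw [map_smul, coeff_prod_X_sub_C (R := F), coeff_prod_X_sub_C (R := F), aeval_X_left_apply,
    map_mul, map_pow, map_neg, map_one]

/-- Write the product as `(T - X p) * g`, where the coefficients of `g` do not involve `X p`. -/
theorem pderiv_coeff_prod (p : Fin n) (i : ℕ) :
    pderiv p ((∏ p', (Polynomial.X - Polynomial.C (X p' : MvPolynomial (Fin n) F))).coeff i) =
      - (∏ p' ∈ Finset.univ.erase p,
        (Polynomial.X - Polynomial.C (X p' : MvPolynomial (Fin n) F))).coeff i := by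
  classical
  have hconst : ∀ i, pderiv p ((∏ p' ∈ Finset.univ.erase p,
        (Polynomial.X - Polynomial.C (X p' : MvPolynomial (Fin n) F))).coeff i) = 0 := by
    refine Finset.prod_induction _ (fun g : Polynomial (MvPolynomial (Fin n) F) =>
      ∀ i, pderiv p (g.coeff i) = 0) ?_ ?_ ?_
    · intro g h hg hh i
      rw [Polynomial.coeff_mul, map_sum]
      refine Finset.sum_eq_zero fun s _ => ?_
      rw [Derivation.leibniz, hg, hh, smul_zero, smul_zero, add_zero]
    · intro i
      rw [Polynomial.coeff_one]
      split_ifs <;> simp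
    · intro p' hp' i
      rw [Polynomial.coeff_sub, Polynomial.coeff_X, Polynomial.coeff_C, map_sub]
      split_ifs <;> simp [pderiv_X_of_ne (Finset.ne_of_mem_erase hp')]
  rw [← Finset.mul_prod_erase _ _ (Finset.mem_univ p), sub_mul, Polynomial.coeff_sub,
    Polynomial.coeff_C_mul, map_sub, Derivation.leibniz, hconst, pderiv_X_self, smul_zero, zero_add,
    smul_eq_mul, mul_one]
  rcases i with _ | i
  · rw [Polynomial.coeff_X_mul_zero, map_zero, zero_sub]
  · rw [Polynomial.coeff_X_mul, hconst, zero_sub]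

theorem jacobianAt_polyInY {K : Type*} [Field K] [Algebra F K] (hL : ∀ j, (L j).IsHomogeneous 1)
    (α : Fin m → F) (y : Fin n → K) (j : Fin m) (p : Fin n) :
    jacobianAt (fun j => polyInY (L j) (α j)) y j p = - ∑ i, algebraMap F K (coeffMatrix L j i) *
      (∏ p' ∈ Finset.univ.erase p, (Polynomial.X - Polynomial.C (y p'))).coeff i := by
  have h1 : ∀ i : ℕ, aeval y ((∏ p' ∈ Finset.univ.erase p,
        (Polynomial.X - Polynomial.C (X p' : MvPolynomial (Fin n) F))).coeff i) =
      (∏ p' ∈ Finset.univ.erase p, (Polynomial.X - Polynomial.C (y p'))).coeff i := by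
    intro i
    have h2 := Polynomial.coeff_map (aeval (R := F) y).toRingHom (p := ∏ p' ∈ Finset.univ.erase p,
        (Polynomial.X - Polynomial.C (X p' : MvPolynomial (Fin n) F))) i
    rw [Polynomial.map_prod] at h2
    simpa using h2.symm
  simp only [jacobianAt, Matrix.of_apply, polyInY_eq hL, map_add, map_sum, pderiv_C, add_zero,
    ← Finset.sum_neg_distrib]
  refine Finset.sum_congr rfl fun i _ => ?_
  rw [(pderiv p).map_smul, pderiv_coeff_prod, map_smul, map_neg, h1, Algebra.smul_def, mul_neg]

/-- If the values `y p` are at least `n - r` many, then the linear combinations of the coefficients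
of degree at least `r` of the polynomials `∏_{p' ≠ p} (T - y p')` that vanish are trivial. -/
theorem eq_zero_of_sum_mul_coeff_prod_erase {K : Type*} [Field K] [DecidableEq K] (y : Fin n → K)
    (hy : n - r ≤ (Finset.univ.image y).card) (hrn : r < n) (w : Fin n → K)
    (hw : ∀ i : Fin n, (i : ℕ) < r → w i = 0)
    (h : ∀ p, ∑ i : Fin n, w i *
      (∏ p' ∈ Finset.univ.erase p, (Polynomial.X - Polynomial.C (y p'))).coeff i = 0) : w = 0 := by
  classical
  set f : Polynomial K := ∏ p, (Polynomial.X - Polynomial.C (y p)) with hf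
  have hfm : f.Monic := Polynomial.monic_prod_of_monic _ _ fun p _ => Polynomial.monic_X_sub_C _
  have hfn : f.natDegree = n := by simp [hf]
  -- Synthetic division: the coefficients of `f / (T - y p)` are polynomials in `y p` that do not
  -- otherwise depend on `p`.
  have hcoeff : ∀ p i, (∏ p' ∈ Finset.univ.erase p, (Polynomial.X - Polynomial.C (y p'))).coeff i =
      ∑ s ∈ Finset.Icc (i + 1) n, y p ^ (s - (i + 1)) * f.coeff s := by
    intro p i
    have h1 := Polynomial.coeff_divByMonic_X_sub_C f (y p) i
    rw [hfn] at h1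
    rw [← h1, hf, ← Finset.mul_prod_erase _ _ (Finset.mem_univ p),
      Polynomial.mul_divByMonic_cancel_left _ (Polynomial.monic_X_sub_C _)]
  -- The hypothesis says that `W` vanishes at each `y p`. Only indices `i ≥ r` contribute, so its
  -- degree is at most `n - r - 1`, below the number of distinct values.
  let W : Polynomial K := ∑ i : Fin n, Polynomial.C (w i) * ∑ s ∈ Finset.Icc ((i : ℕ) + 1) n,
    Polynomial.C (f.coeff s) * Polynomial.X ^ (s - ((i : ℕ) + 1))
  have hW : W = 0 := by
    refine Polynomial.eq_zero_of_natDegree_lt_card_of_eval_eq_zero' W (Finset.univ.image y) ?_ ?_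
    · intro t ht
      obtain ⟨p, -, rfl⟩ := Finset.mem_image.1 ht
      rw [← h p]
      simp only [W, Polynomial.eval_finsetSum, Polynomial.eval_mul, Polynomial.eval_C,
        Polynomial.eval_pow, Polynomial.eval_X, hcoeff, mul_comm (f.coeff _)]
    · refine lt_of_le_of_lt (Polynomial.natDegree_sum_le_of_forall_le _ _ (n := n - r - 1)
        fun i _ => ?_) (by omega)
      rcases lt_or_ge (i : ℕ) r with hi | hi
      · simp [hw i hi]
      · refine (Polynomial.natDegree_C_mul_le _ _).trans
          (Polynomial.natDegree_sum_le_of_forall_le _ _ fun s hs => ?_)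
        refine (Polynomial.natDegree_C_mul_X_pow_le _ _).trans ?_
        have := (Finset.mem_Icc.1 hs).2
        omega
  -- The system is triangular: as `f` is monic, the `i`-th summand of `W` has coefficient `w i` in
  -- degree `n - (i + 1)` and nothing above. The coefficients of `W` from the top down therefore
  -- give `w 0`, `w 1` and so on.
  have key : ∀ N (i : Fin n), (i : ℕ) = N → w i = 0 := by
    intro N
    induction N using Nat.strong_induction_on with
    | _ N ih =>
      intro i hi
      have h1 := congrArg (fun P => Polynomial.coeff P (n - (N + 1))) hW
      simp only [W, Polynomial.finsetSum_coeff, Polynomial.coeff_C_mul, Polynomial.coeff_X_pow,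
        Polynomial.coeff_zero] at h1
      rw [Finset.sum_eq_single i, Finset.sum_eq_single n] at h1
      · rw [hi, if_pos rfl] at h1
        have : f.coeff n = 1 := by rw [← hfn]; exact hfm
        simpa [this] using h1
      · intro s hs hsn
        have := Finset.mem_Icc.1 hs
        rw [if_neg (by omega), mul_zero]
      · intro hn
        exact absurd (Finset.mem_Icc.2 ⟨by omega, le_rfl⟩) hn
      · intro b _ hb
        rcases lt_trichotomy (b : ℕ) N with hbN | hbN | hbN
        · rw [ih b hbN b rfl, zero_mul]
        · exact absurd (Fin.ext (hbN.trans hi.symm)) hb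
        · rw [Finset.sum_eq_zero, mul_zero]
          intro s hs
          have := Finset.mem_Icc.1 hs
          rw [if_neg (by omega), mul_zero]
      · simp
  exact _root_.funext fun i => key i i rfl

/-- With at least `n - r` distinct values, a relation `v` among the rows yields the vanishing
combination `v * coeffMatrix L`. It is zero by the preceding lemma, and independence of the forms
gives `v = 0`. -/
theorem card_image_lt_of_rank_lt {K : Type*} [Field K] [DecidableEq K] [Algebra F K]
    (hL : ∀ j, (L j).IsHomogeneous 1) (hLind : LinearIndependent F L) (hrn : r < n)
    (α : Fin m → F) (y : Fin n → K)
    (hrank : (jacobianAt (fun j => polyInY (L j) (α j)) y).rank < m) :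
    (Finset.univ.image y).card < n - r := by
  by_contra! hcard
  refine hrank.ne ?_
  have : LinearIndependent K (jacobianAt (fun j => polyInY (L j) (α j)) y).row := by
    rw [Fintype.linearIndependent_iff]
    intro v hv
    have hl := Fintype.linearIndependent_iff.1
      (linearIndependent_map_algebraMap (K := K) (linearIndependent_coeffMatrix hL hLind))
    refine hl v (eq_zero_of_sum_mul_coeff_prod_erase y hcard hrn _ ?_ ?_)
    · intro i hi
      rw [Finset.sum_apply]
      refine Finset.sum_eq_zero fun j _ => ?_
      simp [coeffMatrix, hi.not_ge]
    · intro p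
      have h1 := congrFun hv p
      rw [Finset.sum_apply] at h1
      simp only [Pi.smul_apply, Matrix.row, jacobianAt_polyInY hL, smul_eq_mul, mul_neg,
        Finset.sum_neg_distrib, Pi.zero_apply, neg_eq_zero, Finset.mul_sum] at h1
      rw [← h1, Finset.sum_comm]
      refine Finset.sum_congr rfl fun i _ => ?_
      rw [Finset.sum_apply, Finset.sum_mul]
      refine Finset.sum_congr rfl fun j _ => ?_
      rw [Pi.smul_apply, Matrix.map_apply, smul_eq_mul, mul_assoc]
  simpa using this.rank_matrix

end CoefficientForms

/-! ### Dimension of the set of points with few distinct coordinates -/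

section Covering

variable {K : Type*} [Field K] [IsAlgClosed K] {n : ℕ}

/-- Modulo the identifications prescribed by `π` at most `d` of the generators `y p` remain, so the
coordinate ring is a quotient of a polynomial ring in `d` variables. -/
theorem dim_zeroLocus_le_of_adjoin_eq_top {y : Fin n → MvPolynomial (Fin n) K}
    (hy : Algebra.adjoin K (Set.range y) = ⊤) {d : ℕ} (π : Fin n → Fin d) :
    dim (zeroLocus K (Ideal.span {z | ∃ p p', π p = π p' ∧ z = y p - y p'})) ≤
      ((d : ℕ) : WithBot ℕ∞) := by
  classical
  set I := Ideal.span {z | ∃ p p', π p = π p' ∧ z = y p - y p'} with hI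
  rw [dim_eq_ringKrullDim (isVariety_zeroLocus I)]
  set J := vanishingIdeal K (zeroLocus K I)
  have hIJ : I ≤ J := le_vanishingIdeal_zeroLocus I
  let g : MvPolynomial (Fin d) K →ₐ[K] MvPolynomial (Fin n) K ⧸ J := aeval fun t =>
    if h : ∃ p, π p = t then Ideal.Quotient.mk J (y h.choose) else 0
  have hg : ∀ p, g (X (π p)) = Ideal.Quotient.mk J (y p) := by
    intro p
    have h : ∃ p', π p' = π p := ⟨p, rfl⟩
    simp only [g, aeval_X, dif_pos h]
    rw [Ideal.Quotient.eq]
    exact hIJ (Ideal.subset_span ⟨_, _, h.choose_spec, rfl⟩)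
  have hsurj : Function.Surjective g := by
    rw [← AlgHom.range_eq_top, eq_top_iff]
    have h1 : (⊤ : Subalgebra K (MvPolynomial (Fin n) K ⧸ J)) =
        (Algebra.adjoin K (Set.range y)).map (Ideal.Quotient.mkₐ K J) := by
      rw [hy, Algebra.map_top, eq_comm, AlgHom.range_eq_top]
      exact Ideal.Quotient.mkₐ_surjective K J
    rw [h1, AlgHom.map_adjoin, Algebra.adjoin_le_iff]
    rintro _ ⟨_, ⟨p, rfl⟩, rfl⟩
    exact ⟨X (π p), hg p⟩
  refine (ringKrullDim_le_of_surjective g.toRingHom hsurj).trans ?_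
  rw [MvPolynomial.ringKrullDim_of_isNoetherianRing, ringKrullDim_eq_zero_of_field]
  simp

/-- Labelling the at most `d` values at a point by `Fin d` places it in one of the finitely many
loci indexed by `π : Fin n → Fin d`; an irreducible variety lies in a single one. -/
theorem dim_le_of_card_image_le [DecidableEq K] {y : Fin n → MvPolynomial (Fin n) K}
    (hy : Algebra.adjoin K (Set.range y) = ⊤) {d : ℕ} {T : Set (Fin n → K)}
    (hT : ∀ x ∈ T, (Finset.univ.image fun p => aeval x (y p)).card ≤ d) :
    dim T ≤ ((d : ℕ) : WithBot ℕ∞) := by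
  refine dim_le_of_forall_irreducible fun W hW hWT => ?_
  have hcov : W ⊆ ⋃ π ∈ (Finset.univ : Finset (Fin n → Fin d)),
      zeroLocus K (Ideal.span {z | ∃ p p', π p = π p' ∧ z = y p - y p'}) := by
    intro x hx
    have hc := hT x (hWT hx)
    set s := Finset.univ.image fun p => aeval x (y p) with hs
    have hmem : ∀ p, aeval x (y p) ∈ s := fun p => Finset.mem_image_of_mem _ (Finset.mem_univ p)
    let e : s → Fin d := fun c => Fin.castLE hc (s.equivFin c)
    have he : Function.Injective e := (Fin.castLE_injective hc).comp s.equivFin.injective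
    refine Set.mem_iUnion₂.2 ⟨fun p => e ⟨aeval x (y p), hmem p⟩, Finset.mem_univ _, ?_⟩
    rw [zeroLocus_span]
    rintro _ ⟨p, p', hpp, rfl⟩
    rw [map_sub, sub_eq_zero]
    exact congrArg Subtype.val (he hpp)
  obtain ⟨π, -, hπ⟩ := hW.subset_of_subset_biUnion _ _ hcov
  exact (dim_mono hπ).trans (dim_zeroLocus_le_of_adjoin_eq_top hy π)

end Covering

/-! ### Tangent spaces and the Jacobian in the coordinates `Y` -/

section Tangent

variable {K : Type*} [Field K] {n : ℕ}

theorem sum_pderiv_eq_evalLinearForms {y : Fin n → MvPolynomial (Fin n) K}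
    (hy : ∀ p, (y p).IsHomogeneous 1) (x v : Fin n → K) (p : Fin n) :
    ∑ i, aeval x (pderiv i (y p)) * v i = evalLinearForms y v p := by
  rw [evalLinearForms_apply hy, eq_sum_of_isHomogeneous_one (hy p)]
  simp only [map_sum, map_mul, aeval_X, algHom_C]
  refine Finset.sum_congr rfl fun i _ => ?_
  rw [Finset.sum_eq_single i]
  · rw [pderiv_C_mul]; simp
  · intro j _ hj
    simp [pderiv_X_of_ne hj]
  · simp

/-- Chain rule: the differential of the linear substitution `y` is `evalLinearForms y` at every
point. -/
theorem sum_pderiv_aeval {F : Type*} [Field F] [Algebra F K] {y : Fin n → MvPolynomial (Fin n) K}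
    (hy : ∀ p, (y p).IsHomogeneous 1) (x v : Fin n → K) (g : MvPolynomial (Fin n) F) :
    ∑ i, aeval x (pderiv i (aeval y g)) * v i =
      ∑ p, aeval (fun p => aeval x (y p)) (pderiv p g) * evalLinearForms y v p := by
  have hcomp : ∀ g : MvPolynomial (Fin n) F,
      aeval x (aeval y g) = aeval (fun p => aeval x (y p)) g := by
    intro g
    have : ((aeval x : MvPolynomial (Fin n) K →ₐ[K] K).restrictScalars F).comp (aeval y) =
        aeval fun p => aeval x (y p) := MvPolynomial.algHom_ext fun p => by simp
    exact DFunLike.congr_fun this g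
  induction g using MvPolynomial.induction_on with
  | C a =>
    have : (algebraMap F (MvPolynomial (Fin n) K)) a = C (algebraMap F K a) := rfl
    simp [this]
  | add f g hf hg => simp only [map_add, add_mul, Finset.sum_add_distrib, hf, hg]
  | mul_X f p hf =>
    simp only [map_mul, aeval_X, Derivation.leibniz, smul_eq_mul, map_add, add_mul,
      Finset.sum_add_distrib, hcomp]
    congr 1
    · simp only [mul_assoc, ← Finset.mul_sum, sum_pderiv_eq_evalLinearForms hy]
      congr 1
      rw [Finset.sum_eq_single p]
      · simp
      · intro q _ hq
        simp [pderiv_X_of_ne hq.symm]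
      · simp
    · simp only [mul_assoc, ← Finset.mul_sum, hf]

theorem mem_tangentSpace_iff {m : ℕ} {R : Fin m → MvPolynomial (Fin n) K} {V : Set (Fin n → K)}
    (hI : vanishingIdeal K V = Ideal.span (Set.range R)) {x : Fin n → K} (hx : x ∈ V)
    (v : Fin n → K) :
    v ∈ tangentSpace V x ↔ ∀ j, ∑ i, aeval x (pderiv i (R j)) * v i = 0 := by
  refine ⟨fun h j => h _ (hI ▸ Ideal.subset_span (Set.mem_range_self j)), fun h f hf => ?_⟩
  rw [hI] at hf
  have hx0 : ∀ f ∈ Ideal.span (Set.range R), aeval x f = 0 := fun f hf => by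
    rw [← hI] at hf; exact hf x hx
  induction hf using Submodule.span_induction with
  | mem f hf => obtain ⟨j, rfl⟩ := hf; exact h j
  | zero => simp
  | add f g _ _ hf hg => simp only [map_add, add_mul, Finset.sum_add_distrib, hf, hg, add_zero]
  | smul a f hfm hf =>
    simp only [smul_eq_mul, Derivation.leibniz, map_add, map_mul, hx0 f hfm, zero_mul, add_zero,
      mul_assoc, ← Finset.mul_sum, hf, mul_zero]

/-- The tangent space is the kernel of the Jacobian in `Y` composed with an invertible linear map,
so rank-nullity applies. -/
theorem finrank_tangentSpace {F : Type*} [Field F] [Algebra F K] {m k : ℕ} (hn : m + k = n)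
    {y : Fin n → MvPolynomial (Fin n) K} (hy : ∀ p, (y p).IsHomogeneous 1)
    (hinj : Function.Injective (evalLinearForms y))
    (G : Fin m → MvPolynomial (Fin n) F) {V : Set (Fin n → K)}
    (hI : vanishingIdeal K V = Ideal.span (Set.range fun j => aeval y (G j)))
    {x : Fin n → K} (hx : x ∈ V) (hrank : (jacobianAt G fun p => aeval x (y p)).rank = m) :
    Module.finrank K (tangentSpace V x) = k := by
  set J := jacobianAt G fun p => aeval x (y p)
  have hker : tangentSpace V x = LinearMap.ker (J.mulVecLin ∘ₗ evalLinearForms y) := by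
    ext v
    rw [mem_tangentSpace_iff hI hx, LinearMap.mem_ker, _root_.funext_iff]
    refine forall_congr' fun j => ?_
    rw [sum_pderiv_aeval hy]
    rfl
  have hrange : LinearMap.range (evalLinearForms y) = ⊤ :=
    LinearMap.range_eq_top.2 (LinearMap.injective_iff_surjective.1 hinj)
  have h1 := LinearMap.finrank_range_add_finrank_ker (J.mulVecLin ∘ₗ evalLinearForms y)
  rw [LinearMap.range_comp_of_range_eq_top _ hrange, Module.finrank_fin_fun] at h1
  have h2 : Module.finrank K (LinearMap.range J.mulVecLin) = m := hrank
  rw [hker]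
  omega

end Tangent

/-! ### Local dimension and the singular locus -/

section Equidimensional

variable {K : Type*} [Field K] [IsAlgClosed K] {n k : ℕ} {V : Set (Fin n → K)}

theorem dimAt_eq_of_equidimensional (hV : IsVariety V)
    (h : ∀ C ∈ components V, dim C = ((k : ℕ) : WithBot ℕ∞)) {x : Fin n → K} (hx : x ∈ V) :
    dimAt V x = ((k : ℕ) : WithBot ℕ∞) := by
  refine le_antisymm (iSup_le fun C => iSup_le fun hC => iSup_le fun _ => (h C hC).le) ?_
  obtain ⟨C, hC, hxC⟩ := exists_component_mem hV hx
  rw [← h C hC]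
  exact le_iSup_of_le C (le_iSup_of_le hC (le_iSup_of_le hxC le_rfl))

theorem dim_eq_of_equidimensional (hV : IsVariety V) (hne : V.Nonempty)
    (h : ∀ q ∈ (vanishingIdeal K V).minimalPrimes,
      ringKrullDim (MvPolynomial (Fin n) K ⧸ q) = (k : WithBot ℕ∞)) :
    dim V = ((k : ℕ) : WithBot ℕ∞) := by
  have hC : ∀ C ∈ components V, dim C = ((k : ℕ) : WithBot ℕ∞) := fun C hC => by
    rw [dim_eq_ringKrullDim hC.1.1.isVariety, h _ (vanishingIdeal_mem_minimalPrimes hV hC)]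
  refine le_antisymm (dim_le_of_forall_irreducible fun W hW hWV => ?_) ?_
  · have := isPrime_vanishingIdeal hW
    obtain ⟨q, hq, hqW⟩ := Ideal.exists_minimalPrimes_le (vanishingIdeal_anti_mono (k := K) (K := K) hWV)
    rw [dim_eq_ringKrullDim hW.isVariety, ← h q hq]
    exact ringKrullDim_le_of_surjective _ (Ideal.Quotient.factor_surjective hqW)
  · obtain ⟨x, hx⟩ := hne
    obtain ⟨C, hCV, -⟩ := exists_component_mem hV hx
    rw [← hC C hCV]
    exact dim_mono hCV.1.2

theorem singularLocus_subset_rank_lt {F : Type*} [Field F] [Algebra F K] {m : ℕ} (hn : m + k = n)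
    {y : Fin n → MvPolynomial (Fin n) K} (hy : ∀ p, (y p).IsHomogeneous 1)
    (hinj : Function.Injective (evalLinearForms y)) (G : Fin m → MvPolynomial (Fin n) F)
    (hV : IsVariety V) (hI : vanishingIdeal K V = Ideal.span (Set.range fun j => aeval y (G j)))
    (h : ∀ C ∈ components V, dim C = ((k : ℕ) : WithBot ℕ∞)) :
    singularLocus V ⊆ {x | (jacobianAt G fun p => aeval x (y p)).rank < m} := by
  rintro x ⟨hx, hsing⟩
  change (jacobianAt G fun p => aeval x (y p)).rank < m
  refine lt_of_le_of_ne ?_ fun hrank => hsing ?_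
  · have := (jacobianAt G fun p => aeval x (y p)).rank_le_card_height
    rwa [Fintype.card_fin] at this
  · rw [dimAt_eq_of_equidimensional hV h hx, finrank_tangentSpace hn hy hinj G hI hx hrank]

theorem span_range_ne_top_of_isRegular {S : Type*} [CommRing S] {m : ℕ} {f : Fin m → S}
    (hf : RingTheory.Sequence.IsRegular S (List.ofFn f)) : Ideal.span (Set.range f) ≠ ⊤ := by
  have h1 := hf.top_ne_smul
  rw [smul_eq_mul, Ideal.mul_top, Ideal.ofList] at h1
  intro h
  refine h1 ?_
  rw [← h]
  congr 1
  ext x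
  simp [List.mem_ofFn]

/-- A nonzero constant would generate the unit ideal, and zero is a zero divisor on a nonzero
quotient. The counting argument needs this in order to divide exponents by the degrees. -/
theorem totalDegree_pos_of_isRegular {R σ : Type*} [Field R] {m : ℕ}
    {f : Fin m → MvPolynomial σ R}
    (hf : RingTheory.Sequence.IsRegular (MvPolynomial σ R) (List.ofFn f)) (j : Fin m) :
    0 < (f j).totalDegree := by
  have htop := span_range_ne_top_of_isRegular hf
  by_contra h
  have hc := totalDegree_eq_zero_iff_eq_C.1 (Nat.le_zero.1 (not_lt.1 h))
  by_cases h0 : coeff 0 (f j) = 0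
  · rw [h0, map_zero] at hc
    have h1 := (isWeaklyRegular_ofFn_iff f).1 hf.toIsWeaklyRegular j 1 (by rw [hc]; simp)
    exact htop ((Ideal.eq_top_iff_one _).2 (Ideal.span_mono (Set.image_subset_range _ _) h1))
  · refine htop (Ideal.eq_top_of_isUnit_mem _ (Ideal.subset_span (Set.mem_range_self j)) ?_)
    rw [hc]
    exact (isUnit_iff_ne_zero.2 h0).map C

end Equidimensional

end SparseFamily

end

/-! ### Proof of the theorem -/

theorem theorem5p1 {F K : Type*} [Field F] [Fintype F] [Field K] [Algebra F K] [IsAlgClosure F K]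
    (m r n : ℕ) (hm : 0 < m) (hq : n < Fintype.card F) (hmr : m + 2 ≤ r) (hrn : r + m ≤ n)
    (lam : ℕ → ℕ) (hlam : ∑ i ∈ Finset.Icc 1 n, i * lam i = n)
    (θ : ℕ → K) (hθ : ∀ i ∈ Finset.Icc 1 n, SparseFamily.IsNormalElement F i (θ i))
    (L : Fin m → MvPolynomial (Set.Ico r n) F) (hLhom : ∀ j, (L j).IsHomogeneous 1)
    (hLind : LinearIndependent F L) (α : Fin m → F)
    (Y : Fin n → MvPolynomial (Fin n) K)
    (hY : Y = SparseFamily.linearFormY F (SparseFamily.patternBlocks n lam hlam) θ)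
    (R : Fin m → MvPolynomial (Fin n) K)
    (hR : ∀ j, R j = SparseFamily.polyR (SparseFamily.patternBlocks n lam hlam) θ (L j) (α j))
    (V : Set (Fin n → K)) (hV : V = {x | ∀ j, MvPolynomial.aeval x (R j) = 0}) :
    (SparseFamily.IsIdealTheoreticCompleteIntersection V R ∧
      SparseFamily.dim V = ((n - m : ℕ) : WithBot ℕ∞) ∧
      (∀ C ∈ SparseFamily.components V, SparseFamily.dim C = ((n - m : ℕ) : WithBot ℕ∞)) ∧
      SparseFamily.degree V ≤ ((∏ j, (R j).totalDegree : ℕ) : ℕ∞)) ∧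
    SparseFamily.dim {x : Fin n → K |
        (SparseFamily.jacobianAt (fun j => SparseFamily.polyInY (L j) (α j))
          (fun k => MvPolynomial.aeval x (Y k))).rank < m} ≤ ((n - r - 1 : ℕ) : WithBot ℕ∞) ∧
    SparseFamily.dim (SparseFamily.singularLocus V) ≤ ((n - r - 1 : ℕ) : WithBot ℕ∞) := by
  classical
  have : IsAlgClosed K := IsAlgClosure.isAlgClosed F
  have hn : m + (n - m) = n := by omega
  have hyhom : ∀ p, (Y p).IsHomogeneous 1 := fun p => by
    rw [hY]; exact SparseFamily.isHomogeneous_linearFormY _ _ _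
  have hyinj : Function.Injective (SparseFamily.evalLinearForms Y) := by
    rw [hY]; exact SparseFamily.injective_evalLinearForms_linearFormY _ _ hθ
  obtain ⟨τ, hτ⟩ := SparseFamily.exists_algEquiv_of_isHomogeneous_one hyhom hyinj
  have hRY : R = fun j => aeval Y (SparseFamily.polyInY (L j) (α j)) := by
    ext1 j; rw [hR, hY]; rfl
  obtain ⟨hreg, hrad, hmin⟩ := SparseFamily.regular_radical_equidimensional hn (by omega) τ
    (fun i : Fin n => (∏ p, (Polynomial.X - Polynomial.C (τ (X p)))).coeff i) (fun _ => rfl)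
    ((SparseFamily.coeffMatrix L).map (algebraMap F K))
    (SparseFamily.linearIndependent_map_algebraMap
      (SparseFamily.linearIndependent_coeffMatrix hLhom hLind))
    -- From `m + 2 ≤ r`, indices below 2 are below `r`, where the coefficient matrix is zero by
    -- definition.
    (fun j i hi => by simp [SparseFamily.coeffMatrix, show ¬ r ≤ (i : ℕ) by omega])
    (fun j => algebraMap F K (α j)) R (fun j => by
      rw [hRY]
      simp only [SparseFamily.aeval_polyInY hLhom, hτ, Matrix.map_apply, algebraMap_smul]
      rfl)
  have hVz : V = zeroLocus K (Ideal.span (Set.range R)) := by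
    rw [hV, zeroLocus_span]; ext x; simp
  have hVar : SparseFamily.IsVariety V := ⟨_, hVz⟩
  -- By the Nullstellensatz and radicality, the `R j` generate the full ideal of `V`, as the tangent
  -- space computation requires.
  have hI : vanishingIdeal K V = Ideal.span (Set.range R) := by
    rw [hVz, vanishingIdeal_zeroLocus_eq_radical, hrad.radical]
  have hne : V.Nonempty := by
    by_contra h
    rw [Set.not_nonempty_iff_eq_empty] at h
    rw [h, vanishingIdeal_empty] at hI
    exact SparseFamily.span_range_ne_top_of_isRegular hreg hI.symm
  have hcomp : ∀ C ∈ SparseFamily.components V,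
      vanishingIdeal K C ∈ (Ideal.span (Set.range R)).minimalPrimes := fun C hC =>
    hI ▸ SparseFamily.vanishingIdeal_mem_minimalPrimes hVar hC
  have hdimC : ∀ C ∈ SparseFamily.components V,
      SparseFamily.dim C = ((n - m : ℕ) : WithBot ℕ∞) := fun C hC => by
    rw [SparseFamily.dim_eq_ringKrullDim hC.1.1.isVariety, (hmin _ (hcomp C hC)).2]
  have hrank : SparseFamily.dim {x : Fin n → K |
        (SparseFamily.jacobianAt (fun j => SparseFamily.polyInY (L j) (α j))
          (fun k => MvPolynomial.aeval x (Y k))).rank < m} ≤ ((n - r - 1 : ℕ) : WithBot ℕ∞) := by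
    refine SparseFamily.dim_le_of_card_image_le (y := Y) ?_ fun x hx => ?_
    · have : Set.range Y = τ.toAlgHom '' Set.range X := by
        rw [← Set.range_comp]; congr 1; ext1 p; exact (hτ p).symm
      rw [this, ← AlgHom.map_adjoin, adjoin_range_X, Algebra.map_top, AlgHom.range_eq_top]
      exact τ.surjective
    · have := SparseFamily.card_image_lt_of_rank_lt hLhom hLind (by omega) α _ hx
      omega
  refine ⟨⟨⟨hV, hreg, hrad⟩, SparseFamily.dim_eq_of_equidimensional hVar hne
    (fun q hq => (hmin q (hI ▸ hq)).2), hdimC, ?_⟩, hrank, ?_⟩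
  · exact SparseFamily.degree_le_prod_totalDegree hn R
      ((SparseFamily.isWeaklyRegular_ofFn_iff R).1 hreg.toIsWeaklyRegular)
      (SparseFamily.totalDegree_pos_of_isRegular hreg) hVz hdimC
      fun C hC M hM => ((hmin _ (hcomp C hC)).1 M hM).ge
  · refine (SparseFamily.dim_mono (SparseFamily.singularLocus_subset_rank_lt hn hyhom hyinj
      (fun j => SparseFamily.polyInY (L j) (α j)) hVar ?_ hdimC)).trans hrank
    rw [hI, hRY]
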